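/- All groups are finite. A subgroup $M$ of a group $G$ is called modular in $G$ if $\langle X, M\cap Z\rangle=\langle X,M\rangle\cap Z$ for all subgroups $X\le Z$ of $G$, and $\langle M, Y\cap Z\rangle=\langle M,Y\rangle\cap Z$ for all subgroups $Y, Z$ of $G$ with $M\le Z$. A subgroup $H$ of $G$ is called submodular in $G$ if there is a chain of subgroups $H=H_0\le H_1\le\dots\le H_s=G$ such that $H_{i-1}$ is modular in $H_i$ for $i=1,\dots,s$. Let $sm\mathfrak U$ be the class of all groups $G$ such that every Sylow subgroup of $G$ is submodular in $G$. A class of groups $\mathfrak F$ (closed under isomorphism) is a formation if it is closed under quotients and if $G/A\in\mathfrak F$ and $G/B\in\mathfrak F$, with $A,B\unlhd G$, imply $G/(A\cap B)\in\mathfrak F$; a formation is hereditary if it is closed under subgroups, and saturated if $G/\Phi(G)\in\mathfrak F$ implies $G\in\mathfrak F$, where $\Phi(G)$ is the Frattini subgroup of $G$. Theorem 3.1. Let $G$ be a group. Then the following hold: 1) if $G\in sm\mathfrak U$ and $H\le G$, then $H\in sm\mathfrak U$; 2) if $G\in sm\mathfrak U$ and $N\unlhd G$, then $G/N\in sm\mathfrak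 U$; 3) if $N_1,N_2\unlhd G$ and $G/N_1,\,G/N_2\in sm\mathfrak U$, then $G/(N_1\cap N_2)\in sm\mathfrak U$; 4) if $H_1,H_2\unlhd G$, $H_1,H_2\in sm\mathfrak U$ and $H_1\cap H_2=1$, then $H_1\times H_2\in sm\mathfrak U$ (both as the subgroup $H_1H_2$ of $G$ and as the external direct product); 5) if $G/\Phi(G)\in sm\mathfrak U$, then $G\in sm\mathfrak U$; 6) the class $sm\mathfrak U$ is a hereditary saturated formation. -/

import Mathlib

universe u

/-- A subgroup `M` of `G` is modular in `G`: it is a modular element, in the sense of Kurosh,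
of the lattice of all subgroups of `G`. -/
structure IsModularSubgroup {G : Type u} [Group G] (M : Subgroup G) : Prop where
  sup_inf_of_le : ∀ X Z : Subgroup G, X ≤ Z → X ⊔ (M ⊓ Z) = (X ⊔ M) ⊓ Z
  sup_inf_of_ge : ∀ Y Z : Subgroup G, M ≤ Z → M ⊔ (Y ⊓ Z) = (M ⊔ Y) ⊓ Z

/-- A subgroup `H` of `G` is submodular in `G`: there is a chain
`H = C 0 ≤ C 1 ≤ ⋯ ≤ C s = G` in which every `C i` is a modular subgroup of the group
`C (i + 1)`. (Only the values `C 0, …, C s` matter; `s = 0` is allowed.) -/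
def IsSubmodularSubgroup {G : Type u} [Group G] (H : Subgroup G) : Prop :=
  ∃ (s : ℕ) (C : ℕ → Subgroup G), C 0 = H ∧ C s = ⊤ ∧
    ∀ i < s, C i ≤ C (i + 1) ∧ IsModularSubgroup ((C i).subgroupOf (C (i + 1)))

/-- The class `smU` of all finite groups in which every Sylow subgroup is submodular. -/
structure SmU (G : Type u) [Group G] : Prop where
  finite : Finite G
  sylow_submodular : ∀ p : ℕ, p.Prime → ∀ P : Sylow p G,
    IsSubmodularSubgroup (P : Subgroup G)

/-- A property of groups, regarded as a collection of groups. -/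
abbrev GroupProperty : Type (u + 1) := (G : Type u) → [Group G] → Prop

/-- A formation of finite groups: a class of finite groups (closed under isomorphism) that is
closed under quotients and under quotients by intersections of two normal subgroups. -/
structure IsFormation (F : GroupProperty.{u}) : Prop where
  finite : ∀ (G : Type u) [Group G], F G → Finite G
  iso : ∀ (G H : Type u) [Group G] [Group H], F G → Nonempty (G ≃* H) → F H
  quotient : ∀ (G : Type u) [Group G], F G → ∀ (N : Subgroup G) [N.Normal], F (G ⧸ N)
  subdirect : ∀ (G : Type u) [Group G] [Finite G] (A B : Subgroup G) [A.Normal] [B.Normal],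
    F (G ⧸ A) → F (G ⧸ B) → F (G ⧸ (A ⊓ B))

/-- A class of groups is hereditary if it contains all subgroups of its members. -/
def IsHereditary (F : GroupProperty.{u}) : Prop :=
  ∀ (G : Type u) [Group G], F G → ∀ H : Subgroup G, F H

/-- A class of finite groups is saturated if it contains every finite group `G` for which it
contains the quotient of `G` by the Frattini subgroup `Φ(G)`. -/
def IsSaturated (F : GroupProperty.{u}) : Prop :=
  ∀ (G : Type u) [Group G] [Finite G], F (G ⧸ frattini G) → F G

/-! Modularity inside a subgroup passes to intersections, images and preimages, hence so does
submodularity. With the lifting of Sylow subgroups along homomorphisms this settles subgroups,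
quotients and direct products; `G ⧸ (A ⊓ B)` embeds in a product.

The substance is saturation. By `SmU.largestSylowNormal` the Sylow subgroups for the largest prime
`p` are normal. In a minimal counterexample the normalisers `N(Q)` of the Sylow `p`-subgroups are
maximal and modular, which forces `|Q| = p` and bounds `|N(Q)|`. For the smallest prime `s`,
Burnside's transfer makes a Sylow `s`-subgroup nonabelian; it then has order `s³` and is maximal and
modular. Two of these meet in a normal subgroup of index `s` in each, which must be trivial: a
contradiction.

Suppose next that every normal subgroup of prime power order is a `q`-group. The centraliser of the
normal Sylow `q`-subgroup is then a `q`-group, and `le_centralizer_of_submodularIn` makes every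
other Sylow subgroup trivial or elementary abelian with `p ∣ q - 1`. Conversely,
`submodularIn_of_elementary` shows that such a `P` is submodular in `P E` for every elementary
abelian normal `q`-subgroup `E`.

For a normal `N ≤ Φ(G)`, induct on the order and choose such an `E ≠ 1` inside `N`. If some normal
`r`-subgroup `K ≠ 1` with `r ≠ q` exists, `G` embeds in `G/K × G/E`. Otherwise the description
applies to `G/E`, so `P` is submodular in `P E`, which is submodular in `G`. -/

section

open Subgroup

/-! ### Modularity and submodularity relative to an ambient group. -/

/-- `M` is a modular subgroup of `H`, both being subgroups of an ambient group. -/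
structure Subgroup.ModularIn {G : Type*} [Group G] (M H : Subgroup G) : Prop where
  le : M ≤ H
  sup_inf_of_le : ∀ X Z : Subgroup G, X ≤ Z → Z ≤ H → X ⊔ (M ⊓ Z) = (X ⊔ M) ⊓ Z
  sup_inf_of_ge : ∀ Y Z : Subgroup G, Y ≤ H → M ≤ Z → Z ≤ H → M ⊔ (Y ⊓ Z) = (M ⊔ Y) ⊓ Z

/-- `P` is a submodular subgroup of `H`, both being subgroups of an ambient group. -/
abbrev Subgroup.SubmodularIn {G : Type*} [Group G] (P H : Subgroup G) : Prop :=
  Relation.ReflTransGen Subgroup.ModularIn P H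

namespace Subgroup

variable {G : Type*} [Group G] {G' : Type*} [Group G']

theorem ModularIn.of_le {M H : Subgroup G} (le : M ≤ H)
    (h₁ : ∀ X Z : Subgroup G, X ≤ Z → Z ≤ H → (X ⊔ M) ⊓ Z ≤ X ⊔ (M ⊓ Z))
    (h₂ : ∀ Y Z : Subgroup G, Y ≤ H → M ≤ Z → Z ≤ H → (M ⊔ Y) ⊓ Z ≤ M ⊔ (Y ⊓ Z)) :
    M.ModularIn H where
  le := le
  sup_inf_of_le X Z hXZ hZ := le_antisymm
    (sup_le (le_inf le_sup_left hXZ) (inf_le_inf_right _ le_sup_right)) (h₁ X Z hXZ hZ)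
  sup_inf_of_ge Y Z hY hM hZ := le_antisymm
    (sup_le (le_inf le_sup_left hM) (inf_le_inf_right _ le_sup_right)) (h₂ Y Z hY hM hZ)

theorem ModularIn.inf {M H : Subgroup G} (h : M.ModularIn H) (U : Subgroup G) :
    (M ⊓ U).ModularIn (H ⊓ U) := by
  have key : ∀ X Z : Subgroup G, X ≤ Z → Z ≤ H ⊓ U → (X ⊔ M) ⊓ Z ≤ X ⊔ (M ⊓ U ⊓ Z) := by
    intro X Z hXZ hZ
    rw [inf_assoc, inf_eq_right.2 (hZ.trans inf_le_right),
      h.sup_inf_of_le X Z hXZ (hZ.trans inf_le_left)]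
  refine .of_le (inf_le_inf_right _ h.le)
    (fun X Z hXZ hZ => (inf_le_inf_right _ (sup_le_sup_left inf_le_left _)).trans (key X Z hXZ hZ))
    fun Y Z hY hMZ hZ => ?_
  -- The second law for `M` needs a subgroup above `M`, so `Z` is enlarged to `Z ⊔ M`; inside `H ⊓
  -- U` this adds nothing, by `key`.
  have h1 : Y ⊓ (Z ⊔ M) ≤ Y ⊓ Z := by
    refine le_inf inf_le_left ((le_inf (inf_le_right) ?_).trans
      (show (Z ⊔ M) ⊓ (H ⊓ U) ≤ Z from ?_))
    · exact inf_le_left.trans hY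
    · exact (key Z (H ⊓ U) hZ le_rfl).trans (sup_le le_rfl (inf_le_left.trans hMZ))
  have h2 := h.sup_inf_of_ge Y (Z ⊔ M) (hY.trans inf_le_left) le_sup_right
    (sup_le (hZ.trans inf_le_left) h.le)
  have h3 : (M ⊓ U ⊔ Y) ⊓ Z ≤ (Y ⊓ Z) ⊔ M := by
    calc (M ⊓ U ⊔ Y) ⊓ Z ≤ (M ⊔ Y) ⊓ (Z ⊔ M) :=
          inf_le_inf (sup_le_sup_right inf_le_left _) le_sup_left
      _ = M ⊔ (Y ⊓ (Z ⊔ M)) := h2.symm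
      _ ≤ _ := by rw [sup_comm]; exact sup_le_sup_right h1 _
  calc (M ⊓ U ⊔ Y) ⊓ Z ≤ ((Y ⊓ Z) ⊔ M) ⊓ (H ⊓ U) := le_inf h3 (inf_le_right.trans hZ)
    _ ≤ (Y ⊓ Z) ⊔ (M ⊓ U ⊓ (H ⊓ U)) := key _ _ (inf_le_left.trans hY) le_rfl
    _ ≤ _ := by rw [sup_comm]; exact sup_le_sup_right inf_le_left _

/-- Every subgroup of `H.map f` is the image of its preimage cut down to `H`, so both laws can be
pulled back to `H` and pushed forward again. -/
theorem ModularIn.map {M H : Subgroup G} (h : M.ModularIn H) (f : G →* G') :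
    (M.map f).ModularIn (H.map f) := by
  have key : ∀ X : Subgroup G', X ≤ H.map f → (X.comap f ⊓ H).map f = X := fun X hX => by
    refine le_antisymm (map_le_iff_le_comap.2 inf_le_left) fun x hx => ?_
    obtain ⟨w, hw, rfl⟩ := hX hx
    exact mem_map_of_mem f ⟨hx, hw⟩
  refine .of_le (map_mono h.le) (fun X Z hXZ hZ => ?_) fun Y Z hY hMZ hZ => ?_
  · have := h.sup_inf_of_le (X.comap f ⊓ H) (Z.comap f ⊓ H)
      (inf_le_inf_right _ (comap_mono hXZ)) inf_le_right
    rintro z ⟨hz, hzZ⟩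
    rw [SetLike.mem_coe, ← key X (hXZ.trans hZ), ← map_sup] at hz
    obtain ⟨w, hw, rfl⟩ := hz
    have hwH : w ∈ H := (sup_le inf_le_right h.le) hw
    have hw2 : w ∈ (X.comap f ⊓ H) ⊔ (M ⊓ (Z.comap f ⊓ H)) := by
      rw [this]; exact ⟨hw, hzZ, hwH⟩
    have := mem_map_of_mem f hw2
    rw [map_sup, key X (hXZ.trans hZ)] at this
    refine SetLike.le_def.1 (sup_le_sup_left (le_inf (map_mono inf_le_left) ?_) X) this
    rw [map_le_iff_le_comap]; exact inf_le_right.trans inf_le_left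
  · have := h.sup_inf_of_ge (Y.comap f ⊓ H) (Z.comap f ⊓ H) inf_le_right
      (le_inf (map_le_iff_le_comap.1 hMZ) h.le) inf_le_right
    rintro z ⟨hz, hzZ⟩
    rw [SetLike.mem_coe, ← key Y hY, ← map_sup] at hz
    obtain ⟨w, hw, rfl⟩ := hz
    have hwH : w ∈ H := (sup_le h.le inf_le_right) hw
    have hw2 : w ∈ M ⊔ ((Y.comap f ⊓ H) ⊓ (Z.comap f ⊓ H)) := by
      rw [this]; exact ⟨hw, hzZ, hwH⟩
    have := mem_map_of_mem f hw2
    rw [map_sup] at this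
    refine SetLike.le_def.1 (sup_le_sup_left ?_ (M.map f)) this
    rw [map_le_iff_le_comap, comap_inf]
    exact inf_le_inf inf_le_left inf_le_left

/-- The laws hold for images inside `f.range`. They lift because elements with equal image differ by
an element of the kernel, which lies in `M.comap f`. -/
theorem ModularIn.comap {M H : Subgroup G'} (h : M.ModularIn H) (f : G →* G') :
    (M.comap f).ModularIn (H.comap f) := by
  have hM : (M.comap f).map f = M ⊓ f.range := by rw [map_comap_eq, inf_comm]
  have hH : ∀ Z : Subgroup G, Z ≤ H.comap f → Z.map f ≤ H ⊓ f.range := fun Z hZ =>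
    le_inf (map_le_iff_le_comap.2 hZ) (map_le_range f Z)
  have h' := h.inf f.range
  refine .of_le (comap_mono h.le) (fun X Z hXZ hZ => ?_) fun Y Z hY hMZ hZ => ?_
  · rintro z ⟨hz, hzZ⟩
    have h1 : f z ∈ X.map f ⊔ ((M ⊓ f.range) ⊓ Z.map f) := by
      rw [h'.sup_inf_of_le (X.map f) (Z.map f) (map_mono hXZ) (hH Z hZ), ← hM, ← map_sup]
      exact ⟨mem_map_of_mem f hz, mem_map_of_mem f hzZ⟩
    have h2 : X.map f ⊔ ((M ⊓ f.range) ⊓ Z.map f) ≤ (X ⊔ (M.comap f ⊓ Z)).map f := by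
      rw [map_sup]
      refine sup_le_sup_left ?_ _
      rintro _ ⟨⟨hm, -⟩, w, hw, rfl⟩
      exact mem_map_of_mem f ⟨hm, hw⟩
    obtain ⟨w, hw, hwz⟩ := h2 h1
    have hwZ : w ∈ Z := (sup_le hXZ inf_le_right) hw
    have hk : w⁻¹ * z ∈ M.comap f ⊓ Z :=
      ⟨by simp [hwz], Z.mul_mem (Z.inv_mem hwZ) hzZ⟩
    have := mul_mem hw (mem_sup_right (S := X) hk)
    rwa [mul_inv_cancel_left] at this
  · rintro z ⟨hz, hzZ⟩
    have h1 : f z ∈ (M ⊓ f.range) ⊔ (Y.map f ⊓ Z.map f) := by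
      rw [h'.sup_inf_of_ge (Y.map f) (Z.map f) (hH Y hY) (hM ▸ map_mono hMZ) (hH Z hZ), ← hM,
        ← map_sup]
      exact ⟨mem_map_of_mem f hz, mem_map_of_mem f hzZ⟩
    have h2 : (M ⊓ f.range) ⊔ (Y.map f ⊓ Z.map f) ≤ (M.comap f ⊔ (Y ⊓ Z)).map f := by
      rw [map_sup, hM]
      refine sup_le_sup_left ?_ _
      rintro _ ⟨⟨y, hy, rfl⟩, w, hw, hwy⟩
      refine mem_map_of_mem f ⟨hy, ?_⟩
      have hk : w⁻¹ * y ∈ M.comap f := by simp [hwy]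
      have := Z.mul_mem hw (hMZ hk)
      rwa [mul_inv_cancel_left] at this
    obtain ⟨w, hw, hwz⟩ := h2 h1
    have hk : w⁻¹ * z ∈ M.comap f := by simp [hwz]
    have := mul_mem hw (mem_sup_left (T := Y ⊓ Z) hk)
    rwa [mul_inv_cancel_left] at this

theorem ModularIn.bot (H : Subgroup G) : (⊥ : Subgroup G).ModularIn H :=
  .of_le bot_le (by intros; simp) (by intros; simp)

theorem SubmodularIn.le {P H : Subgroup G} (h : P.SubmodularIn H) : P ≤ H := by
  induction h with
  | refl => exact le_rfl
  | tail _ h ih => exact ih.trans h.le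

theorem SubmodularIn.inf {P H : Subgroup G} (h : P.SubmodularIn H) (U : Subgroup G) :
    (P ⊓ U).SubmodularIn (H ⊓ U) :=
  Relation.ReflTransGen.lift (· ⊓ U) (fun _ _ (h : ModularIn _ _) => h.inf U) _ _ h

theorem SubmodularIn.map {P H : Subgroup G} (h : P.SubmodularIn H) (f : G →* G') :
    (P.map f).SubmodularIn (H.map f) :=
  Relation.ReflTransGen.lift (Subgroup.map f) (fun _ _ (h : ModularIn _ _) => h.map f) _ _ h

theorem SubmodularIn.comap {P H : Subgroup G'} (h : P.SubmodularIn H) (f : G →* G') :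
    (P.comap f).SubmodularIn (H.comap f) :=
  Relation.ReflTransGen.lift (Subgroup.comap f) (fun _ _ (h : ModularIn _ _) => h.comap f) _ _ h

theorem SubmodularIn.mono {P H K : Subgroup G} (h : P.SubmodularIn H) (hPK : P ≤ K)
    (hK : K ≤ H) : P.SubmodularIn K := by
  simpa [inf_eq_left.2 hPK, inf_eq_right.2 hK] using h.inf K

theorem SubmodularIn.inf_of_top {P Q : Subgroup G} (hP : P.SubmodularIn ⊤)
    (hQ : Q.SubmodularIn ⊤) : (P ⊓ Q).SubmodularIn ⊤ := by
  have := hP.inf Q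
  rw [top_inf_eq] at this
  exact this.trans hQ

/-- A proper submodular subgroup lies in a proper modular subgroup. -/
theorem SubmodularIn.exists_modularIn_top {P : Subgroup G} (h : P.SubmodularIn ⊤) (hP : P ≠ ⊤) :
    ∃ M : Subgroup G, M ≠ ⊤ ∧ P.SubmodularIn M ∧ M.ModularIn ⊤ := by
  have : ∀ H : Subgroup G, P.SubmodularIn H → H = ⊤ →
      ∃ M : Subgroup G, M ≠ ⊤ ∧ P.SubmodularIn M ∧ M.ModularIn ⊤ := by
    intro H h
    induction h with
    | refl => exact fun h => absurd h hP
    | @tail M H hPM hMH ih =>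
      intro hH
      by_cases hM : M = ⊤
      · exact ih hM
      · exact ⟨M, hM, hPM, hH ▸ hMH⟩
  exact this ⊤ h rfl

theorem modularIn_top_iff {G : Type u} [Group G] {M : Subgroup G} :
    M.ModularIn ⊤ ↔ IsModularSubgroup M :=
  ⟨fun h => ⟨fun X Z hXZ => h.sup_inf_of_le X Z hXZ le_top,
    fun Y Z hMZ => h.sup_inf_of_ge Y Z le_top hMZ le_top⟩,
  fun h => ⟨le_top, fun X Z hXZ _ => h.sup_inf_of_le X Z hXZ,
    fun Y Z _ hMZ _ => h.sup_inf_of_ge Y Z hMZ⟩⟩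

theorem subgroupOf_modularIn_top_iff {M H : Subgroup G} (hMH : M ≤ H) :
    (M.subgroupOf H).ModularIn ⊤ ↔ M.ModularIn H := by
  refine ⟨fun h => ?_, fun h => ?_⟩
  · have := h.map H.subtype
    rwa [subgroupOf_map_subtype, inf_eq_left.2 hMH, ← MonoidHom.range_eq_map, range_subtype] at this
  · have := h.comap H.subtype
    rwa [← subgroupOf, ← subgroupOf, subgroupOf_self] at this

theorem submodularIn_iff_subgroupOf {P H : Subgroup G} (hPH : P ≤ H) :
    (P.subgroupOf H).SubmodularIn ⊤ ↔ P.SubmodularIn H := by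
  refine ⟨fun h => ?_, fun h => ?_⟩
  · have := h.map H.subtype
    rwa [subgroupOf_map_subtype, inf_eq_left.2 hPH, ← MonoidHom.range_eq_map, range_subtype] at this
  · have := h.comap H.subtype
    rwa [← subgroupOf, ← subgroupOf, subgroupOf_self] at this

theorem submodularIn_top_iff {G : Type u} [Group G] {P : Subgroup G} :
    P.SubmodularIn ⊤ ↔ IsSubmodularSubgroup P := by
  constructor
  · intro h
    have : ∀ K : Subgroup G, P.SubmodularIn K → ∃ (s : ℕ) (C : ℕ → Subgroup G), C 0 = P ∧ C s = K ∧
        ∀ i < s, C i ≤ C (i + 1) ∧ IsModularSubgroup ((C i).subgroupOf (C (i + 1))) := by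
      intro K h
      induction h with
      | refl => exact ⟨0, fun _ => P, rfl, rfl, by simp⟩
      | @tail M H _ hMH ih =>
        obtain ⟨s, C, h0, hs, hC⟩ := ih
        refine ⟨s + 1, fun i => if i ≤ s then C i else H, by simpa using h0, by simp, ?_⟩
        intro i hi
        rcases Nat.lt_succ_iff_lt_or_eq.1 hi with h | rfl
        · have h' : i + 1 ≤ s := h
          beta_reduce
          rw [if_pos h.le, if_pos h']
          exact hC i h
        · beta_reduce
          rw [if_pos le_rfl, if_neg (Nat.not_succ_le_self i), hs]
          exact ⟨hMH.le, modularIn_top_iff.1 ((subgroupOf_modularIn_top_iff hMH.le).2 hMH)⟩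
    exact this ⊤ h
  · rintro ⟨s, C, rfl, hs, hC⟩
    rw [← hs]
    have : ∀ i ≤ s, (C 0).SubmodularIn (C i) := by
      intro i
      induction i with
      | zero => exact fun _ => .refl
      | succ i ih =>
        intro hi
        obtain ⟨hle, hm⟩ := hC i hi
        exact (ih (Nat.le_of_succ_le hi)).tail
          ((subgroupOf_modularIn_top_iff hle).1 (modularIn_top_iff.2 hm))
    exact this s le_rfl

end Subgroup

/-! ### Closure of the class under subgroups, quotients and products. -/

namespace SmU

variable {G H K : Type u} [Group G] [Group H] [Group K]

theorem submodularIn (h : SmU G) {p : ℕ} [hp : Fact p.Prime] (P : Sylow p G) :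
    (P : Subgroup G).SubmodularIn ⊤ :=
  submodularIn_top_iff.2 (h.sylow_submodular p hp.out P)

theorem of_surjective (h : SmU G) (f : G →* H) (hf : Function.Surjective f) : SmU H := by
  have := h.finite
  refine ⟨Finite.of_surjective f hf, fun p hp Q => ?_⟩
  have := Fact.mk hp
  obtain ⟨P, rfl⟩ := Sylow.mapSurjective_surjective hf p Q
  have h1 := (h.submodularIn P).map f
  rw [← MonoidHom.range_eq_map, MonoidHom.range_eq_top.2 hf] at h1
  exact submodularIn_top_iff.1 h1

theorem of_injective (h : SmU G) (f : H →* G) (hf : Function.Injective f) : SmU H := by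
  have := h.finite
  refine ⟨Finite.of_injective f hf, fun p hp Q => ?_⟩
  have := Fact.mk hp
  obtain ⟨P, hP⟩ := Q.exists_comap_eq_of_injective hf
  rw [← hP]
  exact submodularIn_top_iff.1 ((h.submodularIn P).comap f)

theorem subgroup (h : SmU G) (H : Subgroup G) : SmU H :=
  h.of_injective H.subtype H.subtype_injective

theorem quotient (h : SmU G) (N : Subgroup G) [N.Normal] : SmU (G ⧸ N) :=
  h.of_surjective (QuotientGroup.mk' N) (QuotientGroup.mk'_surjective N)

/-- A Sylow subgroup of the product is the intersection of the preimages of its two projections,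
since that intersection is a `p`-group containing it. -/
theorem prod (hG : SmU G) (hH : SmU H) : SmU (G × H) := by
  have := hG.finite
  have := hH.finite
  refine ⟨inferInstance, fun p hp P => ?_⟩
  have := Fact.mk hp
  have hf : Function.Surjective (MonoidHom.fst G H) := Prod.fst_surjective
  have hs : Function.Surjective (MonoidHom.snd G H) := Prod.snd_surjective
  have h3 := ((hG.submodularIn (P.mapSurjective hf)).comap (MonoidHom.fst G H)).inf_of_top
    ((hH.submodularIn (P.mapSurjective hs)).comap (MonoidHom.snd G H))
  have hpg : IsPGroup p ((comap (MonoidHom.fst G H) (P.mapSurjective hf) ⊓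
      comap (MonoidHom.snd G H) (P.mapSurjective hs) : Subgroup (G × H))) := by
    rintro ⟨⟨a, b⟩, ha, hb⟩
    obtain ⟨k, hk⟩ := (P.mapSurjective hf).2 ⟨a, ha⟩
    obtain ⟨l, hl⟩ := (P.mapSurjective hs).2 ⟨b, hb⟩
    refine ⟨k + l, ?_⟩
    have hk' : a ^ p ^ k = 1 := congrArg Subtype.val hk
    have hl' : b ^ p ^ l = 1 := congrArg Subtype.val hl
    refine Subtype.ext (Prod.ext ?_ ?_)
    · change a ^ p ^ (k + l) = 1
      rw [pow_add, pow_mul, hk', one_pow]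
    · change b ^ p ^ (k + l) = 1
      rw [pow_add, mul_comm, pow_mul, hl', one_pow]
  have hle : (P : Subgroup (G × H)) ≤ comap (MonoidHom.fst G H) (P.mapSurjective hf) ⊓
      comap (MonoidHom.snd G H) (P.mapSurjective hs) := by
    rw [Sylow.coe_mapSurjective, Sylow.coe_mapSurjective]
    exact le_inf (le_comap_map _ _) (le_comap_map _ _)
  rw [P.is_maximal' hpg hle] at h3
  exact submodularIn_top_iff.1 h3

theorem of_ker_inf_ker (hH : SmU H) (hK : SmU K) (f : G →* H) (g : G →* K)
    (h : f.ker ⊓ g.ker = ⊥) : SmU G :=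
  (hH.prod hK).of_injective (f.prod g)
    ((MonoidHom.ker_eq_bot_iff _).1 (by rw [MonoidHom.ker_prod, h]))

theorem quotient_inf (N₁ N₂ : Subgroup G) [N₁.Normal] [N₂.Normal] (h₁ : SmU (G ⧸ N₁))
    (h₂ : SmU (G ⧸ N₂)) : SmU (G ⧸ (N₁ ⊓ N₂)) := by
  refine h₁.of_ker_inf_ker h₂ (QuotientGroup.map _ _ (MonoidHom.id G) inf_le_left)
    (QuotientGroup.map _ _ (MonoidHom.id G) inf_le_right) ?_
  rw [eq_bot_iff]
  rintro x ⟨hx, hy⟩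
  obtain ⟨x, rfl⟩ := QuotientGroup.mk_surjective x
  rw [mem_bot, QuotientGroup.eq_one_iff]
  exact ⟨(QuotientGroup.eq_one_iff x).1 hx, (QuotientGroup.eq_one_iff x).1 hy⟩

theorem sup_of_disjoint (H₁ H₂ : Subgroup G) [H₁.Normal] [H₂.Normal] (h₁ : SmU H₁) (h₂ : SmU H₂)
    (h : H₁ ⊓ H₂ = ⊥) : SmU (H₁ ⊔ H₂ : Subgroup G) := by
  have hc : ∀ (x : H₁) (y : H₂), Commute (H₁.subtype x) (H₂.subtype y) := fun x y =>
    commute_of_normal_of_disjoint H₁ H₂ inferInstance inferInstance (disjoint_iff.2 h) x y x.2 y.2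
  have hr : (MonoidHom.noncommCoprod H₁.subtype H₂.subtype hc).range = H₁ ⊔ H₂ := by
    rw [MonoidHom.noncommCoprod_range, range_subtype, range_subtype]
  rw [← hr]
  exact (h₁.prod h₂).of_surjective _ (MonoidHom.rangeRestrict_surjective _)

end SmU

/-! ### Index lemmas and modular complements of subgroups of prime order. -/

namespace Subgroup

variable {G : Type*} [Group G]

/-- If `C` is normal in a finite group and every element outside `C` generates the group
modulo `C`, then `C` has index one or a prime index. -/
theorem index_eq_one_or_prime [Finite G] (C : Subgroup G) [C.Normal]
    (h : ∀ a, a ∉ C → zpowers a ⊔ C = ⊤) : C.index = 1 ∨ C.index.Prime := by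
  by_cases h1 : C.index = 1
  · exact .inl h1
  obtain ⟨r, hr, hrd⟩ := Nat.exists_prime_and_dvd h1
  have := Fact.mk hr
  -- An element of prime order in the quotient already generates the quotient.
  obtain ⟨x, hx⟩ := exists_prime_orderOf_dvd_card' (G := G ⧸ C) r hrd
  obtain ⟨a, rfl⟩ := QuotientGroup.mk_surjective x
  have ha : a ∉ C := fun ha => by
    rw [(QuotientGroup.eq_one_iff a).2 ha, orderOf_one] at hx
    exact hr.one_lt.ne hx
  have htop := congrArg (map (QuotientGroup.mk' C)) (h a ha)
  rw [map_sup, MonoidHom.map_zpowers, QuotientGroup.map_mk'_self, sup_bot_eq,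
    map_top_of_surjective _ (QuotientGroup.mk'_surjective C)] at htop
  refine .inr ?_
  rw [index, ← card_top (G := G ⧸ C), ← htop, Nat.card_zpowers]
  simpa [hx] using hr

/-- Relative version of `Subgroup.index_eq_one_or_prime`. -/
theorem relIndex_eq_one_or_prime [Finite G] {C D : Subgroup G} (hCD : C ≤ D)
    (hD : D ≤ normalizer (C : Set G)) (h : ∀ a ∈ D, a ∉ C → zpowers a ⊔ C = D) :
    C.relIndex D = 1 ∨ (C.relIndex D).Prime := by
  have := (normal_subgroupOf_iff_le_normalizer hCD).2 hD
  refine index_eq_one_or_prime (C.subgroupOf D) fun a ha => ?_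
  have h1 := h a a.2 (fun h => ha (mem_subgroupOf.2 h))
  rw [eq_top_iff, ← map_subtype_le_map_subtype, map_sup, MonoidHom.map_zpowers,
    subgroupOf_map_subtype, inf_eq_left.2 hCD, ← MonoidHom.range_eq_map, range_subtype]
  exact h1.ge

theorem relIndex_mem_pow_of_isPGroup [Finite G] {p : ℕ} [Fact p.Prime] {E S : Subgroup G}
    (hS : IsPGroup p S) : ∃ n, E.relIndex S = p ^ n :=
  hS.index (E.subgroupOf S)

/-- A subgroup `E` of a finite `p`-group which together with any outside element generates the
group is normal of index `p`. -/
theorem normalizer_and_relIndex_of_zpowers_sup_eq [Finite G] {p : ℕ} [Fact p.Prime]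
    {E S : Subgroup G} (hS : IsPGroup p S) (hES : E ≤ S) (hne : E ≠ S)
    (h : ∀ x ∈ S, x ∉ E → zpowers x ⊔ E = S) :
    S ≤ normalizer (E : Set G) ∧ E.relIndex S = p := by
  have hn : S ≤ normalizer (E : Set G) := by
    -- Normalisers grow in a `p`-group, and one normalising element outside `E` suffices, as it
    -- generates `S` together with `E`.
    have := hS.isNilpotent
    have h1 : E.subgroupOf S < ⊤ := lt_top_iff_ne_top.2 fun h =>
      hne (le_antisymm hES (subgroupOf_eq_top.1 h))
    have h2 := Group.normalizerCondition_of_isNilpotent _ h1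
    obtain ⟨x, hx, hxE⟩ := SetLike.exists_of_lt h2
    rw [← subgroupOf_normalizer_eq hES] at hx
    rw [← h x x.2 (fun h => hxE (mem_subgroupOf.2 h))]
    exact sup_le (zpowers_le.2 (mem_subgroupOf.1 hx)) le_normalizer
  refine ⟨hn, ?_⟩
  obtain ⟨n, hn'⟩ := relIndex_mem_pow_of_isPGroup (E := E) hS
  rcases relIndex_eq_one_or_prime hES hn h with h1 | h1
  · exact absurd (le_antisymm hES (relIndex_eq_one.1 h1)) hne
  · rw [hn'] at h1 ⊢
    rw [h1.eq_one_of_pow, pow_one]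

theorem zpowers_eq_of_prime_card {V : Subgroup G} (hV : (Nat.card V).Prime) {x : G} (hx : x ∈ V)
    (h1 : x ≠ 1) : zpowers x = V := by
  have := Fact.mk hV
  have h := zpowers_eq_top_of_prime_card (G := V) rfl (g := ⟨x, hx⟩) (by simpa using h1)
  have := congrArg (map V.subtype) h
  rwa [MonoidHom.map_zpowers, ← MonoidHom.range_eq_map, range_subtype] at this

theorem mem_centralizer_of_prime_card {V : Subgroup G} (hV : (Nat.card V).Prime) {x : G}
    (hx : x ∈ V) (h1 : x ≠ 1) {d : G} (hd : Commute d x) : d ∈ centralizer (V : Set G) := by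
  rw [← zpowers_eq_of_prime_card hV hx h1, mem_centralizer_iff]
  rintro _ ⟨k, rfl⟩
  exact (hd.zpow_right k).symm

theorem inf_le_normalizer_inf {D H K : Subgroup G} (h₁ : D ≤ normalizer (H : Set G))
    (h₂ : D ≤ normalizer (K : Set G)) : D ≤ normalizer ((H ⊓ K : Subgroup G) : Set G) :=
  (le_inf h₁ h₂).trans inf_normalizer_le_normalizer_inf

theorem le_normalizer_centralizer {D V : Subgroup G} (h : D ≤ normalizer (V : Set G)) :
    D ≤ normalizer (centralizer (V : Set G) : Set G) := by
  rw [le_normalizer_iff] at h ⊢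
  intro d hd c hc
  rw [mem_centralizer_iff] at hc ⊢
  intro v hv
  have := hc _ (h d⁻¹ (D.inv_mem hd) v hv)
  rw [inv_inv] at this
  calc v * (d * c * d⁻¹) = d * (d⁻¹ * v * d * c) * d⁻¹ := by group
    _ = d * (c * (d⁻¹ * v * d)) * d⁻¹ := by rw [this]
    _ = d * c * d⁻¹ * v := by group

/-- A modular complement `D` to a subgroup `V` of prime order normalised by `D` is generated by
its centraliser part and any element outside it. -/
theorem ModularIn.zpowers_sup_centralizer {D V H : Subgroup G} (hD : D.ModularIn H)
    (hV : (Nat.card V).Prime) (hVH : V ≤ H) (hHV : H ≤ normalizer (V : Set G)) (hdisj : D ⊓ V = ⊥)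
    (hsup : D ⊔ V = H) {a : G} (haD : a ∈ D) (ha : a ∉ D ⊓ centralizer (V : Set G)) :
    zpowers a ⊔ (D ⊓ centralizer (V : Set G)) = D := by
  refine le_antisymm (sup_le (zpowers_le.2 haD) inf_le_left) ?_
  have haC : a ∉ centralizer (V : Set G) := fun h => ha ⟨haD, h⟩
  obtain ⟨y, hyV, hya⟩ : ∃ y ∈ V, y * a ≠ a * y := by
    by_contra! h
    exact haC (mem_centralizer_iff.2 h)
  have hy1 : y ≠ 1 := by rintro rfl; simp at hya
  -- Conjugation by `y ∈ V` not commuting with `a`. The commutator `f a * a⁻¹` generates `V`, so `f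
  -- a` and `D` generate `H`, and the modular law for `⟨f a⟩ ≤ f D` reads `⟨f a⟩ ⊔ (D ⊓ f D) = f D`.
  set f : G →* G := (MulAut.conj y).toMonoidHom
  have hf : ∀ g, f g = y * g * y⁻¹ := fun g => rfl
  have hyH : y ∈ H := hVH hyV
  have hZ : D.map f ≤ H := by
    rintro _ ⟨d, hd, rfl⟩
    exact H.mul_mem (H.mul_mem hyH (hD.le hd)) (H.inv_mem hyH)
  have hXZ : zpowers (f a) ≤ D.map f := zpowers_le.2 (mem_map_of_mem f haD)
  have hXD : zpowers (f a) ⊔ D = H := by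
    refine le_antisymm (sup_le (hXZ.trans hZ) hD.le) ?_
    rw [← hsup]
    refine sup_le le_sup_right ?_
    have hbV : f a * a⁻¹ ∈ V := by
      rw [hf, mul_assoc, mul_assoc]
      refine V.mul_mem hyV ?_
      have := (le_normalizer_iff.1 hHV) a (hD.le haD) y⁻¹ (V.inv_mem hyV)
      rwa [mul_assoc] at this
    have hb1 : f a * a⁻¹ ≠ 1 := by
      rw [hf, Ne, mul_inv_eq_one, mul_inv_eq_iff_eq_mul]
      exact hya
    rw [← zpowers_eq_of_prime_card hV hbV hb1, zpowers_le]
    exact mul_mem (mem_sup_left (mem_zpowers _)) (mem_sup_right (D.inv_mem haD))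
  have hmod := hD.sup_inf_of_le _ _ hXZ hZ
  rw [hXD, inf_eq_right.2 hZ] at hmod
  have hcomm : ∀ g ∈ centralizer (V : Set G), f g = g := fun g hg => by
    rw [hf, mem_centralizer_iff.1 hg y hyV, mul_inv_cancel_right]
  -- If `f e ∈ D` with `e ∈ D`, then `f e * e⁻¹` lies in `D ⊓ V = 1`, so `e` commutes with the
  -- generator `y` of `V`. As `f` fixes the centraliser of `V`, it can then be cancelled.
  have hDZ : D ⊓ D.map f ≤ D ⊓ centralizer (V : Set G) := by
    rintro _ ⟨hd, e, he, rfl⟩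
    refine ⟨hd, ?_⟩
    have h1 : f e * e⁻¹ ∈ D ⊓ V := by
      refine ⟨D.mul_mem hd (D.inv_mem he), ?_⟩
      rw [hf, mul_assoc, mul_assoc]
      refine V.mul_mem hyV ?_
      have := (le_normalizer_iff.1 hHV) e (hD.le he) y⁻¹ (V.inv_mem hyV)
      rwa [mul_assoc] at this
    rw [hdisj, mem_bot, mul_inv_eq_one] at h1
    rw [SetLike.mem_coe, h1]
    refine mem_centralizer_of_prime_card hV hyV hy1 ?_
    rw [hf, mul_inv_eq_iff_eq_mul] at h1
    exact h1.symm
  have key : D.map f ≤ (zpowers a ⊔ (D ⊓ centralizer (V : Set G))).map f := by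
    rw [← hmod]
    refine sup_le (zpowers_le.2 (mem_map_of_mem f (mem_sup_left (mem_zpowers a)))) ?_
    refine hDZ.trans fun g hg => ?_
    rw [← hcomm g hg.2]
    exact mem_map_of_mem f (mem_sup_right hg)
  exact (map_le_map_iff_of_injective (MulAut.conj y).injective).1 key

/-- A modular complement to a subgroup of prime order induces on it a group of automorphisms of
order one or a prime. -/
theorem ModularIn.relIndex_centralizer [Finite G] {D V H : Subgroup G} (hD : D.ModularIn H)
    (hV : (Nat.card V).Prime) (hVH : V ≤ H) (hHV : H ≤ normalizer (V : Set G)) (hdisj : D ⊓ V = ⊥)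
    (hsup : D ⊔ V = H) : (centralizer (V : Set G)).relIndex D = 1 ∨
      ((centralizer (V : Set G)).relIndex D).Prime := by
  rw [← inf_relIndex_left]
  exact relIndex_eq_one_or_prime inf_le_left
    (inf_le_normalizer_inf le_normalizer (le_normalizer_centralizer (hD.le.trans hHV)))
    fun a haD ha => hD.zpowers_sup_centralizer hV hVH hHV hdisj hsup haD ha

theorem relIndex_sup_right_of_le_normalizer {H K : Subgroup G} (h : H ≤ normalizer (K : Set G)) :
    K.relIndex (H ⊔ K) = K.relIndex H := by
  have hn : (K.subgroupOf (H ⊔ K)).Normal :=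
    (normal_subgroupOf_iff_le_normalizer le_sup_right).2 (sup_le h le_normalizer)
  have h1 := relIndex_sup_right (H.subgroupOf (H ⊔ K)) (K.subgroupOf (H ⊔ K))
  rw [← subgroupOf_sup le_sup_left le_sup_right, relIndex_subgroupOf le_rfl,
    relIndex_subgroupOf le_sup_left] at h1
  exact h1

theorem card_sup_of_le_normalizer {H K : Subgroup G} (h : H ≤ normalizer (K : Set G)) :
    Nat.card (H ⊔ K : Subgroup G) = K.relIndex H * Nat.card K := by
  rw [← relIndex_sup_right_of_le_normalizer h, ← relIndex_bot_left K,
    ← relIndex_bot_left (H ⊔ K), mul_comm, relIndex_mul_relIndex _ _ _ bot_le le_sup_right]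

theorem card_sup_dvd {H K : Subgroup G} (h : H ≤ normalizer (K : Set G)) :
    Nat.card (H ⊔ K : Subgroup G) ∣ Nat.card H * Nat.card K := by
  rw [card_sup_of_le_normalizer h]
  exact mul_dvd_mul_right (relIndex_dvd_card _ _) _

theorem relIndex_inf_dvd {A B D : Subgroup G} (h : D ≤ normalizer (B : Set G)) :
    (A ⊓ B).relIndex D ∣ A.relIndex D * B.relIndex D := by
  rw [inf_comm, ← relIndex_inf_mul_relIndex, mul_comm]
  refine mul_dvd_mul_left _ ?_
  have hn := (normal_subgroupOf_iff_le_normalizer (inf_le_right : B ⊓ D ≤ D)).2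
    (inf_le_normalizer_inf h le_normalizer)
  rw [inf_subgroupOf_right] at hn
  have := relIndex_dvd_index_of_normal (B.subgroupOf D) (A.subgroupOf D)
  rwa [← inf_subgroupOf_right A, relIndex_subgroupOf inf_le_right] at this

theorem le_of_isPGroup_of_index {K Q : Subgroup G} [Finite G] [K.Normal] {p : ℕ} [Fact p.Prime]
    (hQ : IsPGroup p Q) (h : ¬ p ∣ K.index) : Q ≤ K := by
  obtain ⟨n, hn⟩ := relIndex_mem_pow_of_isPGroup (E := K) hQ
  rw [← relIndex_eq_one, hn]
  rcases n.eq_zero_or_pos with rfl | hpos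
  · simp
  · exact absurd ((dvd_pow_self p hpos.ne').trans (hn ▸ relIndex_dvd_index_of_normal K Q)) h

/-- A subgroup containing all `p`-subgroups, for all primes `p`, is the whole group. -/
theorem le_of_forall_isPGroup_le [Finite G] {H K : Subgroup G}
    (h : ∀ (p : ℕ) (_ : p.Prime) (T : Subgroup G), IsPGroup p T → T ≤ K → T ≤ H) : K ≤ H := by
  rw [← relIndex_eq_one]
  by_contra hne
  obtain ⟨r, hr, hrd⟩ := Nat.exists_prime_and_dvd hne
  have := Fact.mk hr
  let T : Sylow r K := default
  have hT : (T : Subgroup K) ≤ H.subgroupOf K := by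
    rw [subgroupOf, ← map_le_iff_le_comap]
    exact h r hr _ (T.2.map _) (map_subtype_le _)
  exact T.not_dvd_index (hrd.trans (index_dvd_of_le hT))

end Subgroup

/-! ### A minimal counterexample to normality for the largest prime. -/

/-- The Sylow subgroups for the largest prime divisor of the order are normal. -/
def LargestSylowNormal (G : Type*) [Group G] : Prop :=
  ∀ p : ℕ, p.Prime → (∀ r : ℕ, r.Prime → r ∣ Nat.card G → r ≤ p) →
    ∀ P : Sylow p G, (P : Subgroup G).Normal

/-- A minimal counterexample to normality of the Sylow `p`-subgroups of a group in `smU`, for the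
largest prime divisor `p` of its order. -/
structure CriticalSylow (G : Type u) [Group G] (p : ℕ) : Prop where
  smU : SmU G
  prime_le : ∀ r : ℕ, r.Prime → r ∣ Nat.card G → r ≤ p
  proper : ∀ L : Subgroup G, L ≠ ⊤ → LargestSylowNormal L
  not_normal : ∀ Q : Sylow p G, ¬ (Q : Subgroup G).Normal
  sup_eq_top : ∀ (Q : Sylow p G) (K : Subgroup G), K.Normal → K ≠ ⊥ → (Q : Subgroup G) ⊔ K = ⊤

theorem Sylow.inf_normalizer_eq {G : Type*} [Group G] {p : ℕ} (Q R : Sylow p G) :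
    (Q : Subgroup G) ⊓ normalizer ((R : Subgroup G) : Set G) = (Q : Subgroup G) ⊓ R :=
  Q.2.inf_normalizer_sylow R

theorem IsPGroup.le_sylow_of_le_normalizer {G : Type*} [Group G] {p : ℕ} {T : Subgroup G}
    (hT : IsPGroup p T) {Q : Sylow p G} (h : T ≤ normalizer ((Q : Subgroup G) : Set G)) :
    T ≤ Q := by
  have h1 := hT.inf_normalizer_sylow Q
  rw [← Q.coe_coe, inf_eq_left.2 h, eq_comm, inf_eq_left] at h1
  exact h1

theorem Sylow.not_le_of_ne {G : Type*} [Group G] {p : ℕ} {Q R : Sylow p G} (h : Q ≠ R) :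
    ¬ (Q : Subgroup G) ≤ R := fun hle =>
  h (Sylow.ext (Q.3 R.2 hle).symm)

theorem Sylow.not_le_normalizer_of_ne {G : Type*} [Group G] {p : ℕ} {Q R : Sylow p G} (h : Q ≠ R) :
    ¬ (Q : Subgroup G) ≤ normalizer ((R : Subgroup G) : Set G) := fun hle =>
  Sylow.not_le_of_ne h (Q.2.le_sylow_of_le_normalizer hle)

namespace CriticalSylow

/-- The prime `p` still bounds the prime divisors of `|L|`, so minimality applies to `L`. Thus
`N(Q)` contains every proper overgroup of `Q`. -/
theorem le_normalizer_of_le {G : Type u} [Group G] {p : ℕ} [Fact p.Prime]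
    (h : CriticalSylow G p) {L : Subgroup G} (hL : L ≠ ⊤) (Q : Sylow p G)
    (hQ : (Q : Subgroup G) ≤ L) : L ≤ normalizer ((Q : Subgroup G) : Set G) :=
  (normal_subgroupOf_iff_le_normalizer hQ).1 (h.proper L hL p Fact.out
    (fun r hr hrd => h.prime_le r hr (hrd.trans L.card_subgroup_dvd_card)) (Q.subtype hQ))

theorem exists_ne {G : Type u} [Group G] {p : ℕ} (h : CriticalSylow G p) (Q : Sylow p G) :
    ∃ R : Sylow p G, R ≠ Q := by
  by_contra! hall
  have : Subsingleton (Sylow p G) := ⟨fun a b => (hall a).trans (hall b).symm⟩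
  exact h.not_normal Q Q.normal_of_subsingleton

variable {G : Type u} [Group G] {p : ℕ} [Fact p.Prime] (h : CriticalSylow G p)
include h

theorem isCoatom_normalizer (Q : Sylow p G) :
    IsCoatom (normalizer ((Q : Subgroup G) : Set G)) := by
  refine ⟨fun h1 => h.not_normal Q (normalizer_eq_top_iff.1 h1), fun L hL => ?_⟩
  by_contra hne
  exact hL.not_ge (h.le_normalizer_of_le hne Q (le_normalizer.trans hL.le))

theorem zpowers_sup_normalizer (Q : Sylow p G) {x : G}
    (hx : x ∉ normalizer ((Q : Subgroup G) : Set G)) :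
    zpowers x ⊔ normalizer ((Q : Subgroup G) : Set G) = ⊤ :=
  (h.isCoatom_normalizer Q).2 _ (lt_of_le_of_ne le_sup_right fun he =>
    hx (he ▸ mem_sup_left (mem_zpowers x)))

theorem sup_eq_top_of_ne {Q R : Sylow p G} (hne : Q ≠ R) : (Q : Subgroup G) ⊔ R = ⊤ := by
  by_contra hL
  exact Sylow.not_le_normalizer_of_ne hne
    (le_sup_left.trans (h.le_normalizer_of_le hL R le_sup_right))

/-- A proper modular `M ≥ Q` lies in `N(Q)`. For `x` in another Sylow subgroup and outside `N(Q)`,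
`M` and `x` generate `G`, so `N(Q) = M ⊔ (⟨x⟩ ⊓ N(Q))`. The last term lies in `Q ≤ M`, whence `M =
N(Q)`. -/
theorem modularIn_normalizer (Q : Sylow p G) :
    (normalizer ((Q : Subgroup G) : Set G)).ModularIn ⊤ := by
  obtain ⟨M, hM, hQM, hmod⟩ := (h.smU.submodularIn Q).exists_modularIn_top fun hQ =>
    h.not_normal Q (hQ ▸ inferInstance)
  have hMN := h.le_normalizer_of_le hM Q hQM.le
  obtain ⟨R, hR⟩ := h.exists_ne Q
  obtain ⟨x, hxR, hx⟩ := SetLike.not_le_iff_exists.1 (Sylow.not_le_normalizer_of_ne hR)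
  have htop : M ⊔ zpowers x = ⊤ := by
    by_contra hL
    exact hx (h.le_normalizer_of_le hL Q (hQM.le.trans le_sup_left)
      (mem_sup_right (mem_zpowers x)))
  have h1 := hmod.sup_inf_of_ge (zpowers x) _ le_top hMN le_top
  rw [htop, top_inf_eq] at h1
  have h2 : zpowers x ⊓ normalizer ((Q : Subgroup G) : Set G) ≤ M :=
    (inf_le_inf_right _ (zpowers_le.2 hxR)).trans
      ((R.inf_normalizer_eq Q).le.trans (inf_le_right.trans hQM.le))
  rw [sup_eq_left.2 h2] at h1
  exact h1 ▸ hmod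

variable [Finite G]

/-- An `s`-subgroup not contained in the normaliser of a Sylow `p`-subgroup meets it in a normal
subgroup of index `s`. -/
theorem inf_normalizer_relIndex (Q : Sylow p G) {s : ℕ} [Fact s.Prime] {S : Subgroup G}
    (hS : IsPGroup s S) (hSQ : ¬ S ≤ normalizer ((Q : Subgroup G) : Set G)) :
    S ≤ normalizer ((normalizer ((Q : Subgroup G) : Set G) ⊓ S : Subgroup G) : Set G) ∧
      (normalizer ((Q : Subgroup G) : Set G) ⊓ S).relIndex S = s := by
  refine normalizer_and_relIndex_of_zpowers_sup_eq hS inf_le_right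
    (fun h => hSQ (inf_eq_right.1 h)) fun x hxS hx => ?_
  rw [(h.modularIn_normalizer Q).sup_inf_of_le _ S (zpowers_le.2 hxS) le_top,
    h.zpowers_sup_normalizer Q fun hxN => hx ⟨hxN, hxS⟩, top_inf_eq]

/-- The intersection is normal in both subgroups, hence in `G`, which they generate. Were it
nontrivial, `Q = Q ⊔ (Q ⊓ R)` would be all of `G`. -/
theorem inf_eq_bot_of_ne {Q R : Sylow p G} (hne : Q ≠ R) : (Q : Subgroup G) ⊓ R = ⊥ := by
  have h1 := (h.inf_normalizer_relIndex Q R.2 (Sylow.not_le_normalizer_of_ne hne.symm)).1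
  have h2 := (h.inf_normalizer_relIndex R Q.2 (Sylow.not_le_normalizer_of_ne hne)).1
  rw [inf_comm, Sylow.inf_normalizer_eq] at h1 h2
  rw [inf_comm] at h1
  have h3 := sup_le h2 h1
  rw [h.sup_eq_top_of_ne hne] at h3
  by_contra hb
  have := h.sup_eq_top Q _ (normalizer_eq_top_iff.1 (top_le_iff.1 h3)) hb
  rw [sup_eq_left.2 inf_le_left] at this
  exact h.not_normal Q (this ▸ inferInstance)

theorem card_eq (Q : Sylow p G) : Nat.card Q = p := by
  obtain ⟨R, hR⟩ := h.exists_ne Q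
  have h2 := (h.inf_normalizer_relIndex R Q.2 (Sylow.not_le_normalizer_of_ne hR.symm)).2
  rw [inf_comm, Sylow.inf_normalizer_eq, h.inf_eq_bot_of_ne hR.symm, relIndex_bot_left] at h2
  exact h2

/-- The order of the normaliser of a Sylow `p`-subgroup. -/
theorem card_normalizer_dvd (Q : Sylow p G) : ∃ t t' : ℕ, (t = 1 ∨ t.Prime) ∧ (t' = 1 ∨ t'.Prime) ∧
    Nat.card (normalizer ((Q : Subgroup G) : Set G)) ∣ p * (t * t') := by
  obtain ⟨R, hR⟩ := h.exists_ne Q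
  have hp : p.Prime := Fact.out
  -- `N(R) ⊓ N(Q)` is a modular complement to `Q` in `N(Q)`, so it acts on `Q` as a group of order
  -- one or a prime. The same holds for `R`.
  have aux : ∀ {Q R : Sylow p G}, Q ≠ R →
      (normalizer ((R : Subgroup G) : Set G) ⊓ normalizer ((Q : Subgroup G) : Set G)) ⊔
        (Q : Subgroup G) = normalizer ((Q : Subgroup G) : Set G) ∧
      ((centralizer ((Q : Subgroup G) : Set G)).relIndex
        (normalizer ((R : Subgroup G) : Set G) ⊓ normalizer ((Q : Subgroup G) : Set G)) = 1 ∨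
      ((centralizer ((Q : Subgroup G) : Set G)).relIndex
        (normalizer ((R : Subgroup G) : Set G) ⊓ normalizer ((Q : Subgroup G) : Set G))).Prime) := by
    intro Q R hne
    have h1 := (h.modularIn_normalizer R).inf (normalizer ((Q : Subgroup G) : Set G))
    rw [top_inf_eq] at h1
    have h2 : (normalizer ((R : Subgroup G) : Set G) ⊓ normalizer ((Q : Subgroup G) : Set G)) ⊔
        (Q : Subgroup G) = normalizer ((Q : Subgroup G) : Set G) := by
      rw [sup_comm, (h.modularIn_normalizer R).sup_inf_of_le _ _ le_normalizer le_top,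
        (h.isCoatom_normalizer R).2 _ (lt_of_le_of_ne le_sup_right fun he =>
          Sylow.not_le_normalizer_of_ne hne (he ▸ le_sup_left)), top_inf_eq]
    refine ⟨h2, h1.relIndex_centralizer ?_ le_normalizer le_rfl ?_ h2⟩
    · rw [h.card_eq Q]; exact hp
    · rw [eq_bot_iff, ← h.inf_eq_bot_of_ne hne, ← Sylow.inf_normalizer_eq]
      exact le_inf inf_le_right (inf_le_left.trans inf_le_left)
  obtain ⟨h1, h2⟩ := aux hR.symm
  obtain ⟨-, h3⟩ := aux hR
  rw [inf_comm] at h3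
  refine ⟨_, _, h2, h3, ?_⟩
  set D := normalizer ((R : Subgroup G) : Set G) ⊓ normalizer ((Q : Subgroup G) : Set G)
  -- This subgroup centralises `⟨Q, R⟩ = G`, so it is normal. Were it nontrivial, it would generate
  -- `G` with `Q`, although both lie in `N(Q)`.
  have hW : D ⊓ (centralizer ((Q : Subgroup G) : Set G) ⊓
      centralizer ((R : Subgroup G) : Set G)) = ⊥ := by
    set W := D ⊓ (centralizer ((Q : Subgroup G) : Set G) ⊓ centralizer ((R : Subgroup G) : Set G))
    have hc : (⊤ : Subgroup G) ≤ centralizer (W : Set G) := by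
      rw [← h.sup_eq_top_of_ne hR.symm]
      refine sup_le ?_ ?_
      · rw [le_centralizer_iff]; exact inf_le_right.trans inf_le_left
      · rw [le_centralizer_iff]; exact inf_le_right.trans inf_le_right
    by_contra hb
    have hn : W.Normal := normalizer_eq_top_iff.1
      (top_le_iff.1 (hc.trans (centralizer_le_normalizer _)))
    have := h.sup_eq_top Q W hn hb
    exact (h.isCoatom_normalizer Q).1 (top_le_iff.1 (this.ge.trans
      (sup_le le_normalizer (inf_le_left.trans inf_le_right))))
  have hD : Nat.card D ∣ (centralizer ((Q : Subgroup G) : Set G)).relIndex D *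
      (centralizer ((R : Subgroup G) : Set G)).relIndex D := by
    rw [← relIndex_bot_left D, ← hW, inf_relIndex_left]
    exact relIndex_inf_dvd (le_normalizer_centralizer inf_le_left)
  rw [← h1, mul_comm]
  refine (card_sup_dvd inf_le_right).trans ?_
  exact mul_dvd_mul hD (h.card_eq Q).dvd

/-- There are no normal `s`-subgroups for primes `s ≠ p`. -/
theorem eq_bot_of_normal_of_isPGroup {s : ℕ} [Fact s.Prime] (hsp : s < p) {K : Subgroup G}
    (hKn : K.Normal) (hK : IsPGroup s K) : K = ⊥ := by
  by_contra hb
  let Q : Sylow p G := default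
  have htop := h.sup_eq_top Q K hKn hb
  have hco := h.isCoatom_normalizer Q
  have hKN : ¬ K ≤ normalizer ((Q : Subgroup G) : Set G) := fun hle =>
    hco.1 (top_le_iff.1 (htop.ge.trans (sup_le le_normalizer hle)))
  obtain ⟨h1, h2⟩ := h.inf_normalizer_relIndex Q hK hKN
  have h3 : normalizer ((Q : Subgroup G) : Set G) ≤
      normalizer ((normalizer ((Q : Subgroup G) : Set G) ⊓ K : Subgroup G) : Set G) :=
    inf_le_normalizer_inf le_normalizer le_normalizer_of_normal
  have h4 := normalizer_eq_top_iff.1 (top_le_iff.1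
    (htop.ge.trans (sup_le (le_normalizer.trans h3) h1)))
  have h5 : normalizer ((Q : Subgroup G) : Set G) ⊓ K = ⊥ := by
    by_contra hb
    exact hco.1 (top_le_iff.1
      ((h.sup_eq_top Q _ h4 hb).ge.trans (sup_le le_normalizer inf_le_left)))
  -- Now `|K| = s` and `|G|` divides `p * s`. The number of Sylow `p`-subgroups is at most `s < p`
  -- and congruent to `1` modulo `p`, so it is `1`.
  rw [h5, relIndex_bot_left] at h2
  have h6 : Nat.card G ∣ p * s := by
    have := card_sup_dvd (le_normalizer_of_normal (H := K) (K := (Q : Subgroup G)))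
    rwa [htop, card_top, h2, h.card_eq Q] at this
  have hp : p.Prime := Fact.out
  have h7 : (Q : Subgroup G).index ∣ s := by
    rw [← (Q : Subgroup G).card_mul_index, h.card_eq Q] at h6
    exact Nat.dvd_of_mul_dvd_mul_left hp.pos h6
  have h8 : Nat.card (Sylow p G) ≤ s :=
    Nat.le_of_dvd (Nat.Prime.pos Fact.out) (Q.card_dvd_index.trans h7)
  have h9 := card_sylow_modEq_one p G
  have h10 : Nat.card (Sylow p G) = 1 :=
    Nat.ModEq.eq_of_lt_of_lt h9 (h8.trans_lt hsp) hp.one_lt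
  have : Subsingleton (Sylow p G) := (Nat.card_eq_one_iff_unique.1 h10).1
  exact h.not_normal Q Q.normal_of_subsingleton

end CriticalSylow

/-! ### The smallest prime in the minimal counterexample. -/

namespace CriticalSylow

variable {G : Type u} [Group G] [Finite G] {p : ℕ} [Fact p.Prime] (h : CriticalSylow G p)
include h

theorem ne_of_prime_le {s : ℕ} [Fact s.Prime]
    (hs : ∀ r : ℕ, r.Prime → r ∣ Nat.card G → s ≤ r) : s ≠ p := by
  rintro rfl
  have hG : IsPGroup s G := by
    rw [isPGroup_iff_exists_orderOf_dvd_pow]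
    refine ⟨(Nat.card G).primeFactorsList.length, fun g => (orderOf_dvd_natCard g).trans ?_⟩
    rw [← Nat.eq_prime_pow_of_unique_prime_dvd Nat.card_pos.ne' fun hr hrd =>
      le_antisymm (h.prime_le _ hr hrd) (hs _ hr hrd)]
  refine h.not_normal default ?_
  have := (default : Sylow s G).3 (hG.to_subgroup ⊤) le_top
  rw [← this]
  infer_instance

variable {s : ℕ} [Fact s.Prime] (hsG : s ∣ Nat.card G)
  (hs : ∀ r : ℕ, r.Prime → r ∣ Nat.card G → s ≤ r)
include hsG hs

theorem smallest_lt : s < p :=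
  lt_of_le_of_ne (h.prime_le s Fact.out hsG) (h.ne_of_prime_le hs)

theorem smallestSylow_not_normal (S : Sylow s G) : ¬ (S : Subgroup G).Normal := fun hn =>
  S.ne_bot_of_dvd_card hsG (h.eq_bot_of_normal_of_isPGroup (h.smallest_lt hsG hs) hn S.2)

/-- By Burnside's transfer theorem, the Sylow subgroups for the smallest prime divisor are not
abelian. -/
theorem smallestSylow_not_comm (S : Sylow s G) : ¬ IsMulCommutative S := by
  intro hcomm
  have hN : normalizer ((S : Subgroup G) : Set G) ≠ ⊤ := fun hN =>
    h.smallestSylow_not_normal hsG hs S (normalizer_eq_top_iff.1 hN)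
  have hSC : (S : Subgroup G) ≤ centralizer ((S : Subgroup G) : Set G) :=
    le_centralizer_iff_isMulCommutative.2 hcomm
  have hle : normalizer ((S : Subgroup G) : Set G) ≤ centralizer ((S : Subgroup G) : Set G) := by
    refine le_of_forall_isPGroup_le fun t ht T hT hTN => ?_
    have := Fact.mk ht
    rcases eq_or_ne t s with rfl | hts
    · exact (hT.le_sylow_of_le_normalizer hTN).trans hSC
    by_cases hTb : T = ⊥
    · rw [hTb]; exact bot_le
    have htG : t ∣ Nat.card G := by
      rcases hT.card_eq_or_dvd with h1 | h1
      · exact absurd (card_eq_one.1 h1) hTb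
      · exact h1.trans T.card_subgroup_dvd_card
    -- In the proper subgroup `T S` only `t` and `s ≤ t` can divide the order, so its Sylow
    -- `t`-subgroup is normal. It therefore commutes with the normal subgroup `S`.
    set L := T ⊔ (S : Subgroup G) with hLdef
    have hL : L ≠ ⊤ := fun hL => hN (top_le_iff.1 (hL.ge.trans (sup_le hTN le_normalizer)))
    obtain ⟨Y, hY⟩ := (hT.comap_subtype (K := L)).exists_le_sylow
    have hYn : (Y : Subgroup L).Normal := by
      refine h.proper L hL t ht (fun r hr hrd => ?_) Y
      have h1 := hrd.trans (card_sup_dvd hTN)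
      obtain ⟨m, hm⟩ := IsPGroup.iff_card.1 hT
      obtain ⟨n, hn⟩ := IsPGroup.iff_card.1 S.2
      rw [hm, hn, hr.dvd_mul] at h1
      rcases h1 with h1 | h1
      · exact ((Nat.prime_dvd_prime_iff_eq hr ht).1 (hr.dvd_of_dvd_pow h1)).le
      · rw [(Nat.prime_dvd_prime_iff_eq hr Fact.out).1 (hr.dvd_of_dvd_pow h1)]
        exact hs t ht htG
    have hSn : ((S : Subgroup G).subgroupOf L).Normal :=
      (normal_subgroupOf_iff_le_normalizer le_sup_right).2 (sup_le hTN le_normalizer)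
    have hdis : Disjoint (Y : Subgroup L) ((S : Subgroup G).subgroupOf L) :=
      IsPGroup.disjoint_of_ne t s hts _ _ Y.2 S.2.comap_subtype
    intro x hx
    rw [mem_centralizer_iff]
    intro y hy
    have hxL : x ∈ L := mem_sup_left hx
    have hyL : y ∈ L := mem_sup_right hy
    have := commute_of_normal_of_disjoint _ _ hYn hSn hdis ⟨x, hxL⟩ ⟨y, hyL⟩
      (hY (mem_subgroupOf.2 hx)) (mem_subgroupOf.2 hy)
    exact (congrArg Subtype.val this.eq).symm
  -- The normal complement `K` is proper of `s`-power index, hence contains all Sylow `p`-subgroups.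
  -- Being proper it normalises each of them, so there is only one.
  have hc := MonoidHom.ker_transferSylow_isComplement' S hle
  set K := (MonoidHom.transferSylow S hle).ker
  have hKi : K.index = Nat.card S := hc.symm.index_eq_card
  have hK : K ≠ ⊤ := by
    intro hK
    rw [hK, index_top, eq_comm, card_eq_one] at hKi
    exact S.ne_bot_of_dvd_card hsG hKi
  have hpK : ¬ p ∣ K.index := by
    obtain ⟨n, hn⟩ := IsPGroup.iff_card.1 S.2
    rw [hKi, hn]
    intro hp
    exact h.ne_of_prime_le hs
      ((Nat.prime_dvd_prime_iff_eq Fact.out Fact.out).1 (Nat.Prime.dvd_of_dvd_pow Fact.out hp)).symm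
  obtain ⟨R, hR⟩ := h.exists_ne default
  exact Sylow.not_le_normalizer_of_ne hR ((le_of_isPGroup_of_index R.2 hpK).trans
    (h.le_normalizer_of_le hK _ (le_of_isPGroup_of_index (default : Sylow p G).2 hpK)))

/-- A nonabelian `S` has order at least `s³`. A subgroup of index `s` in `S` lies in `N(Q)`, whose
order divides `p * (t * t')` with `t` and `t'` one or prime, so its `s`-part is at most `s²`. -/
theorem card_smallestSylow (S : Sylow s G) : Nat.card S = s ^ 3 ∧
    ∀ Q : Sylow p G, Nat.card (normalizer ((Q : Subgroup G) : Set G)) ∣ p * s ^ 2 := by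
  have hsp : s.Prime := Fact.out
  have hpp : p.Prime := Fact.out
  obtain ⟨n, hn⟩ := IsPGroup.iff_card.1 S.2
  have hn3 : 3 ≤ n := by
    by_contra! hlt
    refine h.smallestSylow_not_comm hsG hs S ?_
    interval_cases n
    · have := (Nat.card_eq_one_iff_unique.1 (hn.trans (pow_zero s))).1
      exact ⟨⟨fun a b => Subsingleton.elim _ _⟩⟩
    · have := isCyclic_of_prime_card (hn.trans (pow_one s))
      exact ⟨⟨fun a b => IsCyclic.commGroup.mul_comm a b⟩⟩
    · exact IsPGroup.isMulCommutative_of_card_eq_prime_sq hn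
  have key : ∀ Q : Sylow p G, n = 3 ∧
      Nat.card (normalizer ((Q : Subgroup G) : Set G)) ∣ p * s ^ 2 := by
    intro Q
    obtain ⟨t, t', ht, ht', hd⟩ := h.card_normalizer_dvd Q
    have hcop : Nat.Coprime s p := (Nat.coprime_primes hsp hpp).2 (h.ne_of_prime_le hs)
    have h0 : ∀ {t}, (t = 1 ∨ t.Prime) → s ∣ t → t = s := by
      rintro t (rfl | ht) hst
      · exact absurd (Nat.dvd_one.1 hst) hsp.one_lt.ne'
      · exact ((Nat.prime_dvd_prime_iff_eq hsp ht).1 hst).symm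
    have h2 : ∀ m, 2 ≤ m → s ^ m ∣ Nat.card (normalizer ((Q : Subgroup G) : Set G)) →
        t = s ∧ t' = s ∧ m = 2 := by
      intro m hm hdm
      have h1 : s ^ m ∣ t * t' := (hcop.pow_left m).dvd_of_dvd_mul_left (hdm.trans hd)
      have h3 : s ^ 2 ∣ t * t' := (pow_dvd_pow s hm).trans h1
      have hts : s ∣ t := by
        by_contra hc
        have := Nat.Coprime.dvd_of_dvd_mul_left
          (((Nat.Prime.coprime_iff_not_dvd hsp).2 hc).pow_left 2) h3
        have h4 := h0 ht' ((dvd_pow_self s two_ne_zero).trans this)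
        rw [h4] at this
        have := Nat.le_of_dvd hsp.pos this
        nlinarith [hsp.one_lt]
      obtain rfl := h0 ht hts
      have hts' : t ∣ t' := by
        rw [pow_two] at h3
        exact Nat.dvd_of_mul_dvd_mul_left hsp.pos h3
      obtain rfl := h0 ht' hts'
      refine ⟨rfl, rfl, le_antisymm ?_ hm⟩
      rw [← pow_two] at h1
      exact (Nat.pow_dvd_pow_iff_le_right hsp.one_lt).1 h1
    have hSN : ¬ (S : Subgroup G) ≤ normalizer ((Q : Subgroup G) : Set G) := by
      intro hle
      have := (h2 n (by omega) (hn ▸ card_dvd_of_le hle)).2.2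
      omega
    obtain ⟨-, h4⟩ := h.inf_normalizer_relIndex Q S.2 hSN
    have h5 : Nat.card (normalizer ((Q : Subgroup G) : Set G) ⊓ S : Subgroup G) = s ^ (n - 1) := by
      have := relIndex_mul_relIndex (⊥ : Subgroup G)
        (normalizer ((Q : Subgroup G) : Set G) ⊓ S) S bot_le inf_le_right
      rw [h4, relIndex_bot_left, relIndex_bot_left, hn] at this
      refine Nat.eq_of_mul_eq_mul_right hsp.pos (this.trans ?_)
      rw [← pow_succ]
      congr 1
      omega
    obtain ⟨rfl, rfl, h6⟩ := h2 (n - 1) (by omega) (h5 ▸ card_dvd_of_le inf_le_left)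
    exact ⟨by omega, by rwa [pow_two]⟩
  exact ⟨by rw [hn, (key default).1], fun Q => (key Q).2⟩

/-- For a proper `L > S` let `R` be its normal Sylow subgroup for its largest prime `r ≠ s`. If `R`
is not in `N(Q)`, then `N(R) = (N(Q) ⊓ N(R)) R` because `N(Q)` is modular and maximal. So `s³` does
not divide `|N(R)|`, although `S ≤ L ≤ N(R)`. -/
theorem isCoatom_smallestSylow (S : Sylow s G) : IsCoatom (S : Subgroup G) := by
  have hsp : s.Prime := Fact.out
  have hpp : p.Prime := Fact.out
  obtain ⟨hcS, hcN⟩ := h.card_smallestSylow hsG hs S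
  have hpN : ∀ Q : Sylow p G, ¬ s ^ 3 ∣ p * p * s ^ 2 := by
    intro Q hd
    have hcop : Nat.Coprime s p := (Nat.coprime_primes hsp hpp).2 (h.ne_of_prime_le hs)
    have := Nat.Coprime.dvd_of_dvd_mul_left ((hcop.mul_right hcop).pow_left 3) hd
    have := (Nat.pow_dvd_pow_iff_le_right hsp.one_lt).1 this
    omega
  refine ⟨fun hS => h.smallestSylow_not_normal hsG hs S (hS ▸ inferInstance), fun L hL => ?_⟩
  by_contra hLt
  have hSL : s ^ 3 ∣ Nat.card L := hcS ▸ card_dvd_of_le hL.le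
  have hL1 : Nat.card L ≠ 1 := fun h1 => by
    rw [h1, Nat.dvd_one] at hSL
    have := Nat.one_lt_pow three_ne_zero hsp.one_lt
    omega
  obtain ⟨r, hr, hrL, hrmax⟩ : ∃ r : ℕ, r.Prime ∧ r ∣ Nat.card L ∧
      ∀ r' : ℕ, r'.Prime → r' ∣ Nat.card L → r' ≤ r := by
    have hne : (Nat.card L).primeFactors.Nonempty :=
      Nat.nonempty_primeFactors.2 (by have : 0 < Nat.card L := Nat.card_pos; omega)
    refine ⟨(Nat.card L).primeFactors.max' hne, ?_, ?_, fun r' hr' hd => ?_⟩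
    · exact Nat.prime_of_mem_primeFactors (Finset.max'_mem _ _)
    · exact Nat.dvd_of_mem_primeFactors (Finset.max'_mem _ _)
    · exact Finset.le_max' _ _ (Nat.mem_primeFactors.2 ⟨hr', hd, Nat.card_pos.ne'⟩)
  have := Fact.mk hr
  rcases eq_or_ne r s with rfl | hrs
  · have hLp : IsPGroup r L := by
      refine IsPGroup.of_card (n := (Nat.card L).primeFactorsList.length) ?_
      exact Nat.eq_prime_pow_of_unique_prime_dvd Nat.card_pos.ne' fun ht htd =>
        le_antisymm (hrmax _ ht htd) (hs _ ht (htd.trans L.card_subgroup_dvd_card))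
    exact hL.ne (S.3 hLp hL.le).symm
  let R' : Sylow r L := default
  have hR'n := h.proper L hLt r hr hrmax R'
  set R := (R' : Subgroup L).map L.subtype
  have hRp : IsPGroup r R := R'.2.map _
  have hRb : R ≠ ⊥ := fun hb =>
    R'.ne_bot_of_dvd_card hrL ((map_eq_bot_iff_of_injective _ L.subtype_injective).1 hb)
  have hLR : L ≤ normalizer (R : Set G) := by
    rw [← normal_subgroupOf_iff_le_normalizer (map_subtype_le _)]
    rwa [subgroupOf, comap_map_eq_self_of_injective L.subtype_injective]
  -- Otherwise, if `r = p`, `R` lies in two distinct Sylow subgroups, which meet trivially; if `r ≠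
  -- p`, the prime `r` divides `p * s ^ 2`, which is impossible.
  obtain ⟨Q, hQ⟩ : ∃ Q : Sylow p G, ¬ R ≤ normalizer ((Q : Subgroup G) : Set G) := by
    by_contra! hall
    obtain ⟨Q, hQ⟩ := h.exists_ne default
    rcases eq_or_ne r p with rfl | hrp
    · refine hRb (eq_bot_iff.2 ?_)
      rw [← h.inf_eq_bot_of_ne hQ]
      exact le_inf (hRp.le_sylow_of_le_normalizer (hall _))
        (hRp.le_sylow_of_le_normalizer (hall _))
    · have h1 : r ∣ Nat.card R := hRp.card_eq_or_dvd.resolve_left fun h1 => hRb (card_eq_one.1 h1)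
      have h2 := (h1.trans (card_dvd_of_le (hall Q))).trans (hcN Q)
      rcases (hr.dvd_mul).1 h2 with h3 | h3
      · exact hrp ((Nat.prime_dvd_prime_iff_eq hr hpp).1 h3)
      · exact hrs ((Nat.prime_dvd_prime_iff_eq hr hsp).1 (hr.dvd_of_dvd_pow h3))
  obtain ⟨x, hxR, hx⟩ := SetLike.not_le_iff_exists.1 hQ
  have h1 : normalizer ((Q : Subgroup G) : Set G) ⊓ normalizer (R : Set G) ⊔ R =
      normalizer (R : Set G) := by
    rw [sup_comm, (h.modularIn_normalizer Q).sup_inf_of_le _ _ le_normalizer le_top,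
      (h.isCoatom_normalizer Q).2 (R ⊔ _) (lt_of_le_of_ne le_sup_right fun he =>
        hx (he ▸ mem_sup_left hxR)), top_inf_eq]
  have h2 := card_sup_dvd (inf_le_right : normalizer ((Q : Subgroup G) : Set G) ⊓
    normalizer (R : Set G) ≤ _)
  rw [h1] at h2
  have h3 := (hSL.trans (card_dvd_of_le hLR)).trans (h2.trans
    (mul_dvd_mul_right ((card_dvd_of_le inf_le_left).trans (hcN Q)) _))
  obtain ⟨k, hk⟩ := IsPGroup.iff_card.1 hRp
  have hcop : Nat.Coprime s r := (Nat.coprime_primes hsp hr).2 hrs.symm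
  rw [hk] at h3
  have h4 := ((hcop.pow_left 3).pow_right k).dvd_of_dvd_mul_right h3
  exact hpN Q (by rw [mul_assoc]; exact h4.mul_left p)

end CriticalSylow

/-- For the smallest prime `s`, a Sylow `s`-subgroup is maximal and submodular, hence modular. Two
distinct ones then meet in a normal subgroup of `G` of index `s` in each; it is trivial, which
contradicts the order `s³`. -/
theorem CriticalSylow.false {G : Type u} [Group G] [Finite G] {p : ℕ} [Fact p.Prime]
    (h : CriticalSylow G p) : False := by
  have hG : Nat.card G ≠ 1 := fun h1 => by
    have := (Nat.card_eq_one_iff_unique.1 h1).1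
    refine h.not_normal default ?_
    rw [Subsingleton.elim ((default : Sylow p G) : Subgroup G) ⊥]
    infer_instance
  have := Fact.mk (Nat.minFac_prime hG)
  have hsG := Nat.minFac_dvd (Nat.card G)
  have hs : ∀ r : ℕ, r.Prime → r ∣ Nat.card G → (Nat.card G).minFac ≤ r := fun r hr hd =>
    Nat.minFac_le_of_dvd hr.two_le hd
  set s := (Nat.card G).minFac
  have hsp : s.Prime := Fact.out
  let S : Sylow s G := default
  have hmod : ∀ S : Sylow s G, (S : Subgroup G).ModularIn ⊤ := by
    intro S
    have hco := h.isCoatom_smallestSylow hsG hs S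
    obtain ⟨M, hM, hSM, hmod⟩ := (h.smU.submodularIn S).exists_modularIn_top hco.1
    rcases hSM.le.eq_or_lt with he | hlt
    · exact he ▸ hmod
    · exact absurd (hco.2 M hlt) hM
  obtain ⟨T, hT⟩ : ∃ T : Sylow s G, T ≠ S := by
    by_contra! hall
    have : Subsingleton (Sylow s G) := ⟨fun a b => (hall a).trans (hall b).symm⟩
    exact h.smallestSylow_not_normal hsG hs S S.normal_of_subsingleton
  have key : ∀ {S T : Sylow s G}, T ≠ S →
      (T : Subgroup G) ≤ normalizer (((S : Subgroup G) ⊓ T : Subgroup G) : Set G) ∧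
      ((S : Subgroup G) ⊓ T).relIndex T = s := by
    intro S T hne
    refine normalizer_and_relIndex_of_zpowers_sup_eq T.2 inf_le_right
      (fun h => Sylow.not_le_of_ne hne (inf_eq_right.1 h)) fun x hxT hx => ?_
    rw [(hmod S).sup_inf_of_le _ (T : Subgroup G) (zpowers_le.2 hxT) le_top,
      (h.isCoatom_smallestSylow hsG hs S).2 _ (lt_of_le_of_ne le_sup_right fun he =>
        hx ⟨he ▸ mem_sup_left (mem_zpowers x), hxT⟩), top_inf_eq]
  obtain ⟨h1, h2⟩ := key hT
  obtain ⟨h3, -⟩ := key hT.symm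
  rw [inf_comm] at h3
  have h4 : (S : Subgroup G) ⊔ T = ⊤ :=
    (h.isCoatom_smallestSylow hsG hs S).2 _ (lt_of_le_of_ne le_sup_left fun he =>
      Sylow.not_le_of_ne hT (he ▸ le_sup_right))
  have h5 := h.eq_bot_of_normal_of_isPGroup (h.smallest_lt hsG hs)
    (normalizer_eq_top_iff.1 (top_le_iff.1 (h4.ge.trans (sup_le h3 h1)))) S.2.to_inf_left
  rw [h5, relIndex_bot_left] at h2
  have h6 := (h.card_smallestSylow hsG hs T).1
  have h7 := h2.symm.trans h6
  exact absurd (Nat.pow_right_injective hsp.two_le ((pow_one s).trans h7)) (by norm_num)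

theorem Sylow.normal_of_le_of_normal {G : Type*} [Group G] [Finite G] {p : ℕ} [Fact p.Prime]
    (P : Sylow p G) {N : Subgroup G} [N.Normal] (hPN : (P : Subgroup G) ≤ N)
    (h : ((P : Subgroup G).subgroupOf N).Normal) : (P : Subgroup G).Normal := by
  rw [← normalizer_eq_top_iff, ← top_le_iff]
  have h1 := P.normalizer_sup_eq_top' hPN
  rw [← P.coe_coe] at h1
  rw [← h1]
  exact sup_le le_rfl ((normal_subgroupOf_iff_le_normalizer hPN).1 h)

/-- In a finite group all of whose Sylow subgroups are submodular, the Sylow subgroups for the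
largest prime divisor of the order are normal. -/
theorem SmU.largestSylowNormal {G : Type u} [Group G] (hG : SmU G) : LargestSylowNormal G := by
  have := hG.finite
  induction hc : Nat.card G using Nat.strong_induction_on generalizing G with
  | _ n ih =>
    subst hc
    intro p hp hmax P
    have := Fact.mk hp
    by_contra hP
    have hproper : ∀ L : Subgroup G, L ≠ ⊤ → LargestSylowNormal L := fun L hL => by
      refine ih (Nat.card L) ?_ (hG.subgroup L) inferInstance rfl
      exact lt_of_le_of_ne (card_le_card_group L) fun he => hL (card_eq_iff_eq_top L |>.1 he)
    have hnot : ∀ Q : Sylow p G, ¬ (Q : Subgroup G).Normal := fun Q hQ => by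
      have := Sylow.unique_of_normal Q hQ
      exact hP (Subsingleton.elim Q P ▸ hQ)
    refine CriticalSylow.false (G := G) (p := p) ⟨hG, hmax, hproper, hnot, fun Q K hK hKb => ?_⟩
    -- By induction `Q K / K` is normal in `G / K`, so `Q K` is normal in `G`. If it is proper, `Q`
    -- is normal in it, hence in `G` by the Frattini argument.
    by_contra hne
    have hq : LargestSylowNormal (G ⧸ K) := by
      refine ih (Nat.card (G ⧸ K)) ?_ (hG.quotient K) inferInstance rfl
      have h1 := K.card_mul_index
      have h2 : 1 < Nat.card K := (one_lt_card_iff_ne_bot K).2 hKb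
      have h3 : 0 < K.index := Nat.pos_of_ne_zero index_ne_zero_of_finite
      rw [← index_eq_card]
      nlinarith
    have hn := hq p hp (fun r hr hd => hmax r hr (hd.trans (index_eq_card K ▸ K.index_dvd_card)))
      (Q.mapSurjective (QuotientGroup.mk'_surjective K))
    have hn' := hn.comap (QuotientGroup.mk' K)
    rw [Sylow.coe_mapSurjective, comap_map_eq, QuotientGroup.ker_mk'] at hn'
    exact hnot Q (Q.normal_of_le_of_normal le_sup_left (hproper _ hne p hp
      (fun r hr hd => hmax r hr (hd.trans (card_subgroup_dvd_card _))) (Q.subtype le_sup_left)))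

/-! ### Submodular `p`-subgroups acting on normal `q`-subgroups. -/

/-- A nontrivial normal `q`-subgroup contains a nontrivial elementary abelian normal subgroup. -/
theorem IsPGroup.exists_normal_elementary {G : Type*} [Group G] [Finite G] {q : ℕ} [Fact q.Prime]
    {Q : Subgroup G} (hQ : IsPGroup q Q) [Q.Normal] (hQb : Q ≠ ⊥) :
    ∃ N : Subgroup G, N.Normal ∧ N ≤ Q ∧ N ≠ ⊥ ∧ (∀ x ∈ N, x ^ q = 1) ∧
      N ≤ centralizer (N : Set G) := by
  have hcomm : ∀ {x y}, x ∈ Q ⊓ centralizer (Q : Set G) → y ∈ Q → Commute y x :=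
    fun hx hy => mem_centralizer_iff.1 hx.2 _ hy
  let N : Subgroup G :=
    { carrier := {x | x ∈ Q ⊓ centralizer (Q : Set G) ∧ x ^ q = 1}
      mul_mem' := fun {a b} ha hb => ⟨mul_mem ha.1 hb.1, by
        rw [(hcomm hb.1 ha.1.1).mul_pow, ha.2, hb.2, one_mul]⟩
      one_mem' := ⟨one_mem _, one_pow _⟩
      inv_mem' := fun {a} ha => ⟨inv_mem ha.1, by rw [inv_pow, ha.2, inv_one]⟩ }
  refine ⟨N, ⟨fun x hx g => ⟨Normal.conj_mem inferInstance x hx.1 g, ?_⟩⟩, fun x hx => hx.1.1, ?_,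
    fun x hx => hx.2, fun x hx => mem_centralizer_iff.2 fun y hy => hcomm hx.1 hy.1.1⟩
  · rw [conj_pow, hx.2, mul_one, mul_inv_cancel]
  · have : Nontrivial Q := (nontrivial_iff_ne_bot Q).2 hQb
    have := hQ.center_nontrivial
    have hd : q ∣ Nat.card (center Q) :=
      (hQ.to_subgroup (center Q)).card_eq_or_dvd.resolve_left Finite.one_lt_card.ne'
    obtain ⟨z, hz⟩ := exists_prime_orderOf_dvd_card' q hd
    intro hb
    have hzN : ((z : Q) : G) ∈ N := by
      refine ⟨⟨(z : Q).2, mem_centralizer_iff.2 fun y hy => ?_⟩, ?_⟩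
      · exact congrArg Subtype.val (mem_center_iff.1 z.2 ⟨y, hy⟩)
      · have := congrArg (fun w : center Q => ((w : Q) : G)) (hz ▸ pow_orderOf_eq_one z)
        simpa using this
    rw [hb, mem_bot] at hzN
    have h1 : z = 1 := Subtype.ext (Subtype.ext hzN)
    rw [h1, orderOf_one] at hz
    exact (Fact.out : q.Prime).one_lt.ne hz

/-- An element `x` of `p`-power order centralising a `q`-subgroup `N`, with `p ≠ q`, commutes with
`y` as soon as the commutator of `x` and `y` lies in `N`. -/
theorem commute_of_commutator_mem {G : Type*} [Group G] {p q : ℕ} [Fact p.Prime] [Fact q.Prime]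
    (hpq : p ≠ q) {N : Subgroup G} (hN : IsPGroup q N) {x y : G} (hx : ∃ k, x ^ p ^ k = 1)
    (hxN : x ∈ centralizer (N : Set G)) (hxy : y⁻¹ * (x * y * x⁻¹) ∈ N) : Commute x y := by
  set n := y⁻¹ * (x * y * x⁻¹) with hn
  have hnx : n * x = x * n := mem_centralizer_iff.1 hxN n hxy
  -- Taking `i = p ^ k` with `x ^ p ^ k = 1` makes the order of `n` a power of `p`; it is also a
  -- power of `q`.
  have key : ∀ i : ℕ, x ^ i * y = y * n ^ i * x ^ i := by
    intro i
    induction i with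
    | zero => simp
    | succ i ih =>
      have h1 : x * y = y * n * x := by rw [hn]; group
      calc x ^ (i + 1) * y = x ^ i * (x * y) := by rw [pow_succ, mul_assoc]
        _ = (x ^ i * y) * (n * x) := by rw [h1]; group
        _ = y * n ^ i * (x ^ i * n) * x := by rw [ih]; group
        _ = y * n ^ i * (n * x ^ i) * x := by
          rw [((show Commute x n from hnx.symm).pow_left i).eq]
        _ = y * n ^ (i + 1) * x ^ (i + 1) := by rw [pow_succ, pow_succ]; group
  obtain ⟨k, hk⟩ := hx
  have h1 := key (p ^ k)
  rw [hk, one_mul, mul_one, left_eq_mul] at h1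
  obtain ⟨l, hl⟩ := hN ⟨n, hxy⟩
  have hl' : n ^ q ^ l = 1 := congrArg Subtype.val hl
  have hcop : Nat.Coprime (p ^ k) (q ^ l) :=
    Nat.Coprime.pow _ _ ((Nat.coprime_primes Fact.out Fact.out).2 hpq)
  have hn1 : n = 1 := by
    have := Nat.dvd_gcd (orderOf_dvd_of_pow_eq_one h1) (orderOf_dvd_of_pow_eq_one hl')
    rw [hcop.gcd_eq_one, Nat.dvd_one, orderOf_eq_one_iff] at this
    exact this
  have := key 1
  rw [hn1] at this
  change x * y = y * x
  simpa using this

theorem MulAut.ker_conjNormal {G : Type*} [Group G] (N : Subgroup G) [N.Normal] :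
    (MulAut.conjNormal : G →* MulAut N).ker = centralizer (N : Set G) := by
  ext g
  rw [MonoidHom.mem_ker, mem_centralizer_iff]
  refine ⟨fun h y hy => ?_, fun h => MulEquiv.ext fun y => Subtype.ext ?_⟩
  · have := congrArg Subtype.val (DFunLike.congr_fun h (⟨y, hy⟩ : N))
    rw [MulAut.conjNormal_apply, mul_inv_eq_iff_eq_mul] at this
    exact this.symm
  · rw [MulAut.conjNormal_apply, ← h y y.2, mul_inv_cancel_right]
    rfl

theorem Subgroup.index_centralizer_dvd_of_prime_card {G : Type*} [Group G] [Finite G]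
    (N : Subgroup G) [N.Normal] {q : ℕ} (hq : q.Prime) (hN : Nat.card N = q) :
    (centralizer (N : Set G)).index ∣ q - 1 := by
  have := Fact.mk hq
  have := isCyclic_of_prime_card hN
  rw [← MulAut.ker_conjNormal, index_ker, ← Nat.totient_prime hq, ← hN, ← IsCyclic.card_mulAut N]
  exact card_subgroup_dvd_card _

/-- Let `P` be a submodular `p`-subgroup complementing a normal `q`-subgroup `Q`. A subgroup `F`
of `P`, contained in all subgroups of index `p` in `P` in case `p ∣ q - 1`, centralises `Q`. -/
theorem le_centralizer_of_submodularIn {G : Type*} [Group G] [Finite G] {p q : ℕ} [Fact p.Prime]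
    [Fact q.Prime] (hpq : p ≠ q) {P Q F : Subgroup G} (hP : IsPGroup p P) (hQ : IsPGroup q Q)
    [hQn : Q.Normal] (htop : P ⊔ Q = ⊤) (hsub : P.SubmodularIn ⊤) (hFP : F ≤ P)
    (hF : p ∣ q - 1 → ∀ S ≤ P, S.relIndex P = p → F ≤ S) : F ≤ centralizer (Q : Set G) := by
  induction hc : Nat.card G using Nat.strong_induction_on generalizing G with
  | _ n ih =>
  subst hc
  by_cases hQb : Q = ⊥
  · subst hQb
    intro x _
    rw [mem_centralizer_iff]
    intro y hy
    rw [coe_bot, Set.mem_singleton_iff] at hy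
    simp [hy]
  have hsubgrp : ∀ M : Subgroup G, M ≠ ⊤ → P.SubmodularIn M →
      F ≤ centralizer ((Q ⊓ M : Subgroup G) : Set G) := by
    intro M hM hPM
    have h1 := ih (Nat.card M) (lt_of_le_of_ne (card_le_card_group M)
      fun he => hM (card_eq_iff_eq_top M |>.1 he)) (P := P.subgroupOf M) (Q := Q.subgroupOf M)
      (F := F.subgroupOf M) hP.comap_subtype hQ.comap_subtype (hQn := inferInstance) ?_
      ((submodularIn_iff_subgroupOf hPM.le).2 hPM) (comap_mono hFP) ?_ rfl
    · intro x hx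
      rw [mem_centralizer_iff]
      rintro y ⟨hyQ, hyM⟩
      exact congrArg Subtype.val (mem_centralizer_iff.1
        (h1 (mem_subgroupOf.2 hx : (⟨x, hPM.le (hFP hx)⟩ : M) ∈ _)) ⟨y, hyM⟩ hyQ)
    · rw [eq_top_iff]
      rintro ⟨m, hm⟩ -
      obtain ⟨a, ha, b, hb, hab⟩ := mem_sup_of_normal_right.1 (htop ▸ mem_top m)
      have haM := hPM.le ha
      have hbM : b ∈ M := by
        have : b = a⁻¹ * m := by rw [← hab]; group
        rw [this]
        exact M.mul_mem (M.inv_mem haM) hm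
      have : (⟨m, hm⟩ : M) = ⟨a, haM⟩ * ⟨b, hbM⟩ := Subtype.ext hab.symm
      rw [this]
      exact mul_mem (mem_sup_left ha) (mem_sup_right hb)
    · intro hd S hSP hS
      have hSP' : S.map M.subtype ≤ P :=
        (map_mono hSP).trans ((subgroupOf_map_subtype P M).le.trans inf_le_left)
      have h2 := hF hd (S.map M.subtype) hSP' ?_
      · intro x hx
        obtain ⟨y, hy, hyx⟩ := h2 hx
        rwa [← Subtype.ext hyx]
      · rw [← hS, ← relIndex_map_map_of_injective S _ M.subtype_injective, subgroupOf_map_subtype,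
          inf_eq_left.2 hPM.le]
  -- Such an `N` suffices: induction applies to `G ⧸ N`, and coprimality lifts commutation modulo
  -- `N` to commutation.
  obtain ⟨N, hNn, hNQ, hNb, hFN⟩ : ∃ N : Subgroup G, N.Normal ∧ N ≤ Q ∧ N ≠ ⊥ ∧
      F ≤ centralizer (N : Set G) := by
    obtain ⟨N, hNn, hNQ, hNb, hNe, hNc⟩ := hQ.exists_normal_elementary hQb
    obtain ⟨M, hM, hPM, hmod⟩ := hsub.exists_modularIn_top fun hPt => hQb <| by
      have := (IsPGroup.disjoint_of_ne p q hpq _ _ hP hQ).eq_bot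
      rwa [hPt, top_inf_eq] at this
    -- If every `⟨v⟩ ⊔ M` is proper, induction inside it shows that `F` centralises `v`.
    by_cases hall : ∀ v ∈ N, zpowers v ⊔ M ≠ ⊤
    · refine ⟨N, hNn, hNQ, hNb, fun x hx => mem_centralizer_iff.2 fun v hv => ?_⟩
      have h1 := hsubgrp _ (hall v hv) (hsub.mono (hPM.le.trans le_sup_right) le_top) hx
      exact mem_centralizer_iff.1 h1 v ⟨hNQ hv, mem_sup_left (mem_zpowers v)⟩
    push Not at hall
    obtain ⟨v, hvN, hv⟩ := hall
    by_cases hMN : M ⊓ N = ⊥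
    · refine ⟨N, hNn, hNQ, hNb, ?_⟩
      -- The modular law gives `N = ⟨v⟩` of order `q`, with modular complement `M`, so `G / C(N)`
      -- has order one or a prime. If `F` did not centralise `N`, then `C_P(N)` would have index `p`
      -- in `P` with `p ∣ q - 1`, and so would contain `F`.
      have h1 := hmod.sup_inf_of_le (zpowers v) N (zpowers_le.2 hvN) le_top
      rw [hv, top_inf_eq, hMN, sup_bot_eq] at h1
      have hv1 : v ≠ 1 := fun h => hNb (by rw [← h1, h, zpowers_one_eq_bot])
      have hcard : Nat.card N = q := by
        rw [← h1, Nat.card_zpowers]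
        exact orderOf_eq_prime (hNe v hvN) hv1
      by_contra hFC
      have hNC : M ⊔ centralizer (N : Set G) = ⊤ := by
        rw [eq_top_iff, ← hv, sup_comm]
        exact sup_le_sup_left ((zpowers_le.2 hvN).trans hNc) _
      have hMNt : M ⊔ N = ⊤ := by
        rw [eq_top_iff, ← hv, sup_comm]
        exact sup_le_sup_left (zpowers_le.2 hvN) _
      have h2 := hmod.relIndex_centralizer (hcard ▸ Fact.out) le_top le_normalizer_of_normal
        hMN hMNt
      rw [← relIndex_sup_right, hNC, relIndex_top_right] at h2
      have h3 := relIndex_dvd_index_of_normal (centralizer (N : Set G)) P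
      have h4 : (centralizer (N : Set G)).relIndex P = p := by
        obtain ⟨m, hm⟩ := relIndex_mem_pow_of_isPGroup (E := centralizer (N : Set G)) hP
        have hne : (centralizer (N : Set G)).relIndex P ≠ 1 := fun h =>
          hFC (hFP.trans (relIndex_eq_one.1 h))
        rcases h2 with h2 | h2
        · rw [h2, Nat.dvd_one] at h3
          exact absurd h3 hne
        · rcases (Nat.dvd_prime h2).1 h3 with h5 | h5
          · exact absurd h5 hne
          · rw [← h5, hm] at h2
            rw [hm, h2.eq_one_of_pow, pow_one]
      refine hFC ((hF ?_ (centralizer (N : Set G) ⊓ P) inf_le_right ?_).trans inf_le_left)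
      · rw [← h4]
        exact h3.trans (index_centralizer_dvd_of_prime_card N Fact.out hcard)
      · rw [inf_relIndex_right, h4]
    -- Normal because `v` centralises it, `M` normalises it, and the two generate `G`; centralised
    -- by `F` by induction in `M`.
    · refine ⟨M ⊓ N, ?_, inf_le_right.trans hNQ, hMN,
        (hsubgrp M hM hPM).trans (centralizer_le fun x hx => ⟨hNQ hx.2, hx.1⟩)⟩
      rw [← normalizer_eq_top_iff, ← top_le_iff, ← hv]
      refine sup_le ((zpowers_le.2 hvN).trans (hNc.trans ((centralizer_le ?_).trans
        (centralizer_le_normalizer _)))) (inf_le_normalizer_inf le_normalizer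
          le_normalizer_of_normal)
      exact fun x hx => hx.2
  have hquot := ih (Nat.card (G ⧸ N)) (by
      have h1 := N.card_mul_index
      have h2 : 1 < Nat.card N := (one_lt_card_iff_ne_bot N).2 hNb
      have h3 : 0 < N.index := Nat.pos_of_ne_zero index_ne_zero_of_finite
      rw [← index_eq_card]
      nlinarith) (P := P.map (QuotientGroup.mk' N)) (Q := Q.map (QuotientGroup.mk' N))
      (F := F.map (QuotientGroup.mk' N)) (hP.map _) (hQ.map _)
      (hQn := hQn.map _ (QuotientGroup.mk'_surjective N)) (by
        rw [← Subgroup.map_sup, htop, map_top_of_surjective _ (QuotientGroup.mk'_surjective N)]) (by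
        have := hsub.map (QuotientGroup.mk' N)
        rwa [map_top_of_surjective _ (QuotientGroup.mk'_surjective N)] at this)
      (map_mono hFP) (by
        intro hd S hSP hS
        rw [map_le_iff_le_comap]
        refine (hF hd (S.comap (QuotientGroup.mk' N) ⊓ P) inf_le_right ?_).trans inf_le_left
        rw [inf_relIndex_right, relIndex_comap, hS]) rfl
  intro x hx
  rw [mem_centralizer_iff]
  intro y hy
  obtain ⟨k, hk⟩ := hP ⟨x, hFP hx⟩
  refine (commute_of_commutator_mem hpq (hQ.to_le hNQ) ⟨k, congrArg Subtype.val hk⟩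
    (hFN hx) ?_).symm
  have h1 := mem_centralizer_iff.1 (hquot (mem_map_of_mem _ hx)) _ (mem_map_of_mem _ hy)
  rw [← QuotientGroup.eq_one_iff]
  change (QuotientGroup.mk' N) _ = 1
  simp only [map_mul, map_inv]
  rw [← h1]
  group

/-! ### Submodularity of elementary abelian complements. -/

/-- In a group whose order divides a product of two primes, all subgroups are modular. -/
theorem Subgroup.ModularIn.of_card_dvd {G : Type*} [Group G] [Finite G] {p q : ℕ} (hp : p.Prime)
    (hq : q.Prime) (hG : Nat.card G ∣ p * q) (M : Subgroup G) : M.ModularIn ⊤ := by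
  -- A chain `1 < X < Z < G` would give the order three prime factors. In the remaining cases both
  -- laws are trivial.
  have key : ∀ {X Z : Subgroup G}, X ≤ Z → X = ⊥ ∨ X = Z ∨ Z = ⊤ := by
    intro X Z hXZ
    by_contra! hne
    have h1 : 1 < Nat.card X := (one_lt_card_iff_ne_bot X).2 hne.1
    have h2 : 1 < X.relIndex Z := by
      have h3 : X.relIndex Z ≠ 1 := fun h => hne.2.1 (le_antisymm hXZ (relIndex_eq_one.1 h))
      have h4 : X.relIndex Z ≠ 0 := index_ne_zero_of_finite
      omega
    have h3 : 1 < Z.index := one_lt_index_of_ne_top hne.2.2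
    have h4 : Nat.card X * X.relIndex Z * Z.index = Nat.card G := by
      rw [mul_assoc, relIndex_mul_index hXZ, card_mul_index]
    have h5 : Nat.card X * X.relIndex Z * Z.index ∣ p * q := h4.symm ▸ hG
    have h6 := (Nat.primeFactorsList_sublist_of_dvd h5
      (mul_ne_zero hp.ne_zero hq.ne_zero)).length_le
    rw [← ArithmeticFunction.cardFactors_apply, ← ArithmeticFunction.cardFactors_apply,
      ArithmeticFunction.cardFactors_mul (by positivity) (by positivity),
      ArithmeticFunction.cardFactors_mul (by positivity) (by positivity),
      ArithmeticFunction.cardFactors_mul hp.ne_zero hq.ne_zero,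
      ArithmeticFunction.cardFactors_apply_prime hp,
      ArithmeticFunction.cardFactors_apply_prime hq] at h6
    rw [← ArithmeticFunction.cardFactors_pos_iff_one_lt] at h1 h2 h3
    omega
  refine .of_le le_top (fun X Z hXZ _ => ?_) fun Y Z _ hMZ _ => ?_
  · rcases key hXZ with rfl | rfl | rfl
    · simp
    · exact inf_le_right.trans le_sup_left
    · simp
  · rcases key hMZ with rfl | rfl | rfl
    · simp
    · exact inf_le_right.trans le_sup_left
    · simp

open Polynomial in
/-- An endomorphism of order dividing `q - 1` of an elementary abelian `q`-group has an
eigenvector. -/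
theorem exists_apply_eq_pow {V : Type*} [CommGroup V] [Finite V] [Nontrivial V] {q : ℕ}
    [Fact q.Prime] (hV : ∀ v : V, v ^ q = 1) (T : V →* V) (hT : ∀ v, T^[q] v = T v) :
    ∃ (k : ℕ) (v : V), v ≠ 1 ∧ T v = v ^ k := by
  let _ : Module (ZMod q) (Additive V) := AddCommGroup.zmodModule (n := q) hV
  have : Module.Finite (ZMod q) (Additive V) := .of_finite
  let f : Module.End (ZMod q) (Additive V) := T.toAdditive.toZModLinearMap q
  -- `X ^ q - X` splits over `ZMod q`, hence so does the minimal polynomial of `f`, which therefore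
  -- has a root.
  have hf : aeval f (X ^ q - X : (ZMod q)[X]) = 0 := by
    rw [map_sub, map_pow, aeval_X, sub_eq_zero]
    refine LinearMap.ext fun v => ?_
    rw [Module.End.pow_apply]
    exact hT v
  have hne : (X ^ q - X : (ZMod q)[X]) ≠ 0 :=
    FiniteField.X_pow_card_sub_X_ne_zero _ (Fact.out : q.Prime).one_lt
  have hsplit : (minpoly (ZMod q) f).Splits :=
    (GaloisField.splits_zmod_X_pow_sub_X q).of_dvd hne (minpoly.dvd _ _ hf)
  obtain ⟨μ, hμ⟩ := hsplit.exists_eval_eq_zero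
    (minpoly.degree_pos (Algebra.IsIntegral.isIntegral f)).ne'
  obtain ⟨v, hv⟩ := (Module.End.hasEigenvalue_of_isRoot (f := f) hμ).exists_hasEigenvector
  refine ⟨μ.val, v.toMul, hv.2, ?_⟩
  have h1 : f v = μ • v := hv.apply_eq_smul
  rw [← ZMod.natCast_zmod_val μ, Nat.cast_smul_eq_nsmul] at h1
  exact h1

theorem Subgroup.Normal.of_le_normalizer_of_sup {G : Type*} [Group G] {P N K : Subgroup G}
    (htop : P ⊔ N = ⊤) (h₁ : P ≤ normalizer (K : Set G)) (h₂ : N ≤ normalizer (K : Set G)) :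
    K.Normal :=
  normalizer_eq_top_iff.1 (top_le_iff.1 (htop.ge.trans (sup_le h₁ h₂)))

/-- An elementary abelian normal `q`-subgroup with an elementary abelian `p`-complement, where
`p ∣ q - 1`, contains a normal subgroup of order `q`. -/
theorem exists_normal_card_eq {G : Type*} [Group G] [Finite G] {p q : ℕ} [Fact q.Prime]
    {P N : Subgroup G} [N.Normal] (hPp : ∀ x ∈ P, x ^ p = 1) (hPc : P ≤ centralizer (P : Set G))
    (hNq : ∀ x ∈ N, x ^ q = 1) (hNc : N ≤ centralizer (N : Set G)) (hd : p ∣ q - 1)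
    (htop : P ⊔ N = ⊤) (hNb : N ≠ ⊥) : ∃ V ≤ N, V.Normal ∧ Nat.card V = q := by
  obtain ⟨V, ⟨hVn, hVN, hVb⟩, hmin⟩ := WellFounded.has_min
    (wellFounded_lt (α := Subgroup G)) {V : Subgroup G | V.Normal ∧ V ≤ N ∧ V ≠ ⊥}
    ⟨N, inferInstance, le_rfl, hNb⟩
  have hcomm : ∀ x ∈ N, ∀ y ∈ N, x * y = y * x := fun x hx y hy =>
    mem_centralizer_iff.1 (hNc hy) x hx
  let _ : CommGroup V := { mul_comm := fun a b => Subtype.ext (hcomm a (hVN a.2) b (hVN b.2)) }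
  have : Nontrivial V := (nontrivial_iff_ne_bot V).2 hVb
  -- An eigenspace `E ≠ 1` of `x` in the minimal normal subgroup `V` is normal, as `P` and `N` are
  -- abelian, so `E = V`. Since `P` thus acts by power maps, cyclic subgroups of `V` are normal.
  have hpow : ∀ x ∈ P, ∃ k : ℕ, ∀ v ∈ V, x * v * x⁻¹ = v ^ k := by
    intro x hx
    set T : V →* V := (MulAut.conjNormal x : MulAut V).toMonoidHom
    have hT1 : ∀ v : V, (T v : G) = x * v * x⁻¹ := fun v => rfl
    have hT : ∀ (i : ℕ) (v : V), (T^[i] v : G) = x ^ i * v * (x ^ i)⁻¹ := by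
      intro i
      induction i with
      | zero => intro v; simp
      | succ i ih =>
        intro v
        rw [Function.iterate_succ_apply', hT1, ih, pow_succ']
        group
    obtain ⟨k, v, hv1, hv⟩ := exists_apply_eq_pow (q := q)
      (fun v : V => Subtype.ext (by simpa using hNq v (hVN v.2)))
      T (fun v => Subtype.ext (by
        rw [hT q]
        have h1 : x ^ q = x := by
          obtain ⟨m, hm⟩ := hd
          have : q = p * m + 1 := by
            have := (Fact.out : q.Prime).pos
            omega
          rw [this, pow_succ, pow_mul, hPp x hx, one_pow, one_mul]
        rw [h1]
        rfl))
    have hv' : x * v * x⁻¹ = (v : G) ^ k := congrArg Subtype.val hv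
    let E : Subgroup G :=
      { carrier := {w | w ∈ V ∧ x * w * x⁻¹ = w ^ k}
        mul_mem' := fun {a b} ha hb => ⟨V.mul_mem ha.1 hb.1, by
          rw [Commute.mul_pow (hcomm a (hVN ha.1) b (hVN hb.1)), ← ha.2, ← hb.2]; group⟩
        one_mem' := ⟨V.one_mem, by simp⟩
        inv_mem' := fun {a} ha => ⟨V.inv_mem ha.1, by rw [inv_pow, ← ha.2]; group⟩ }
    have hEV : E ≤ V := fun w hw => hw.1
    have hEn : E.Normal := by
      refine .of_le_normalizer_of_sup htop ?_ ((hNc.trans (centralizer_le (hEV.trans hVN))).trans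
        (centralizer_le_normalizer _))
      rw [le_normalizer_iff]
      rintro y hy w ⟨hwV, hw⟩
      refine ⟨hVn.conj_mem w hwV y, ?_⟩
      have hxy : x * y = y * x := mem_centralizer_iff.1 (hPc hy) x hx
      rw [conj_pow, ← hw]
      calc x * (y * w * y⁻¹) * x⁻¹ = (x * y) * w * (x * y)⁻¹ := by group
        _ = (y * x) * w * (y * x)⁻¹ := by rw [hxy]
        _ = _ := by group
    have hEeq : E = V := by
      by_contra hne
      refine hmin E ⟨hEn, hEV.trans hVN, fun hb => hv1 (Subtype.ext ?_)⟩ (lt_of_le_of_ne hEV hne)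
      have : (v : G) ∈ E := ⟨v.2, hv'⟩
      rwa [hb, mem_bot] at this
    exact ⟨k, fun w hw => (hEeq ▸ hw : w ∈ E).2⟩
  obtain ⟨v, hv, hv1'⟩ := V.bot_or_exists_ne_one.resolve_left hVb
  have hvn : (zpowers (v : G)).Normal := by
    have hle : zpowers (v : G) ≤ N := zpowers_le.2 (hVN hv)
    refine .of_le_normalizer_of_sup htop ?_ ((hNc.trans (centralizer_le hle)).trans
        (centralizer_le_normalizer _))
    rw [le_normalizer_iff]
    rintro x hx _ ⟨i, rfl⟩
    obtain ⟨k, hk⟩ := hpow x hx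
    change x * (v : G) ^ i * x⁻¹ ∈ _
    rw [hk _ (V.zpow_mem hv i)]
    exact pow_mem (zpow_mem (mem_zpowers _) i) k
  have hVeq : zpowers (v : G) = V := by
    by_contra hne
    exact hmin _ ⟨hvn, zpowers_le.2 (hVN hv), fun hb => hv1' (zpowers_eq_bot.1 hb)⟩
      (lt_of_le_of_ne (zpowers_le.2 hv) hne)
  refine ⟨V, hVN, hVn, ?_⟩
  rw [← hVeq, Nat.card_zpowers]
  exact orderOf_eq_prime (hNq v (hVN hv)) hv1'

/-- A complement of exponent `p` to a normal subgroup of prime order is modular. -/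
theorem modularIn_of_elementary_of_prime_card {G : Type*} [Group G] [Finite G] {p q : ℕ}
    [Fact p.Prime] [Fact q.Prime] {P V : Subgroup G} [V.Normal] (hPp : ∀ x ∈ P, x ^ p = 1)
    (hV : Nat.card V = q) (htop : P ⊔ V = ⊤) : P.ModularIn ⊤ := by
  have hC : (P ⊓ centralizer (V : Set G)).Normal := by
    refine .of_le_normalizer_of_sup htop (inf_le_normalizer_inf le_normalizer
      le_normalizer_of_normal) ?_
    refine le_trans ?_ (centralizer_le_normalizer _)
    rw [le_centralizer_iff]
    exact inf_le_right
  set C := P ⊓ centralizer (V : Set G)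
  -- `P / C` embeds in this cyclic group, where exponent and order of a subgroup agree, so its order
  -- divides `p`. Hence all subgroups of `G ⧸ C` are modular, and `P` is a preimage of one.
  have hcyc : IsCyclic (MulAut V) := by
    have := isCyclic_of_prime_card hV
    have h1 := IsCyclic.mulAutMulEquiv V
    rw [hV] at h1
    exact isCyclic_of_surjective h1.symm h1.symm.surjective
  have h1 : C.relIndex P ∣ p := by
    rw [inf_relIndex_left, ← MulAut.ker_conjNormal, relIndex_ker, ← IsCyclic.exponent_eq_card]
    refine Monoid.exponent_dvd_of_forall_pow_eq_one ?_
    rintro ⟨_, x, hx, rfl⟩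
    refine Subtype.ext ?_
    change (MulAut.conjNormal x) ^ p = 1
    rw [← map_pow, hPp x hx, map_one]
  have h2 : P.index ∣ q := by
    have h3 := card_sup_dvd (le_normalizer_of_normal (H := V) (K := P))
    rw [htop, card_top, hV, ← P.card_mul_index] at h3
    exact Nat.dvd_of_mul_dvd_mul_left Nat.card_pos h3
  have h3 : Nat.card (G ⧸ C) ∣ p * q := by
    rw [← index_eq_card, ← relIndex_mul_index (inf_le_left : C ≤ P)]
    exact mul_dvd_mul h1 h2
  have h4 := (ModularIn.of_card_dvd (Fact.out : p.Prime) (Fact.out : q.Prime) h3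
    (P.map (QuotientGroup.mk' C))).comap (QuotientGroup.mk' C)
  rwa [comap_map_eq, QuotientGroup.ker_mk', comap_top, sup_eq_left.2 inf_le_left] at h4

/-- An elementary abelian `p`-complement to an elementary abelian normal `q`-subgroup, where
`p ∣ q - 1`, is submodular. -/
theorem submodularIn_of_elementary {G : Type*} [Group G] [Finite G] {p q : ℕ}
    [Fact p.Prime] [Fact q.Prime] {P N : Subgroup G} [hNn : N.Normal] (hPp : ∀ x ∈ P, x ^ p = 1)
    (hPc : P ≤ centralizer (P : Set G)) (hNq : ∀ x ∈ N, x ^ q = 1)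
    (hNc : N ≤ centralizer (N : Set G)) (hd : p ∣ q - 1) (htop : P ⊔ N = ⊤) :
    P.SubmodularIn ⊤ := by
  induction hc : Nat.card G using Nat.strong_induction_on generalizing G with
  | _ n ih =>
  subst hc
  by_cases hNb : N = ⊥
  · rw [hNb, sup_bot_eq] at htop
    rw [htop]
  obtain ⟨V, hVN, hVn, hVq⟩ := exists_normal_card_eq hPp hPc hNq hNc hd htop hNb
  -- The bottom step of the chain; the rest is pulled back from `G ⧸ V`.
  have hmod : P.ModularIn (P ⊔ V) := by
    rw [← subgroupOf_modularIn_top_iff le_sup_left]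
    refine modularIn_of_elementary_of_prime_card (p := p) (q := q)
      (V := V.subgroupOf (P ⊔ V)) (fun x hx => Subtype.ext ?_) ?_ ?_
    · exact hPp x hx
    · rw [← hVq]
      exact Nat.card_congr (subgroupOfEquivOfLe le_sup_right).toEquiv
    · rw [← subgroupOf_sup le_sup_left le_sup_right, subgroupOf_self]
  have hsurj := QuotientGroup.mk'_surjective V
  have hquot := ih (Nat.card (G ⧸ V)) (by
      have h1 := V.card_mul_index
      have h2 : 1 < Nat.card V := hVq ▸ (Fact.out : q.Prime).one_lt
      have h3 : 0 < V.index := Nat.pos_of_ne_zero index_ne_zero_of_finite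
      rw [← index_eq_card]
      nlinarith) (P := P.map (QuotientGroup.mk' V)) (N := N.map (QuotientGroup.mk' V))
      (hNn := hNn.map _ hsurj)
      (by rintro _ ⟨x, hx, rfl⟩; rw [← map_pow, hPp x hx, map_one])
      (by
        rintro _ ⟨x, hx, rfl⟩
        rw [mem_centralizer_iff]
        rintro _ ⟨y, hy, rfl⟩
        rw [← map_mul, mem_centralizer_iff.1 (hPc hx) y hy, map_mul])
      (by rintro _ ⟨x, hx, rfl⟩; rw [← map_pow, hNq x hx, map_one])
      (by
        rintro _ ⟨x, hx, rfl⟩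
        rw [mem_centralizer_iff]
        rintro _ ⟨y, hy, rfl⟩
        rw [← map_mul, mem_centralizer_iff.1 (hNc hx) y hy, map_mul])
      (by rw [← Subgroup.map_sup, htop, map_top_of_surjective _ hsurj]) rfl
  have h1 := hquot.comap (QuotientGroup.mk' V)
  rw [comap_map_eq, QuotientGroup.ker_mk', comap_top] at h1
  exact .head hmod h1

theorem le_centralizer_of_submodularIn_sup {G : Type*} [Group G] [Finite G] {p q : ℕ}
    [Fact p.Prime] [Fact q.Prime] (hpq : p ≠ q) {P Q F : Subgroup G} (hP : IsPGroup p P)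
    (hQ : IsPGroup q Q) [Q.Normal] (hsub : P.SubmodularIn (P ⊔ Q)) (hFP : F ≤ P)
    (hF : p ∣ q - 1 → ∀ S ≤ P, S.relIndex P = p → F ≤ S) : F ≤ centralizer (Q : Set G) := by
  set M := P ⊔ Q with hM
  have h1 := le_centralizer_of_submodularIn hpq (P := P.subgroupOf M) (Q := Q.subgroupOf M)
    (F := F.subgroupOf M) hP.comap_subtype hQ.comap_subtype
    (by rw [← subgroupOf_sup le_sup_left le_sup_right, subgroupOf_self])
    ((submodularIn_iff_subgroupOf hsub.le).2 hsub) (comap_mono hFP) (fun hd S hSP hS => ?_)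
  · intro x hx
    rw [mem_centralizer_iff]
    intro y hy
    exact congrArg Subtype.val (mem_centralizer_iff.1
      (h1 (mem_subgroupOf.2 hx : (⟨x, hsub.le (hFP hx)⟩ : M) ∈ _)) ⟨y, mem_sup_right hy⟩ hy)
  · have hSP' : S.map M.subtype ≤ P :=
      (map_mono hSP).trans ((subgroupOf_map_subtype P M).le.trans inf_le_left)
    have h2 := hF hd (S.map M.subtype) hSP' (by
      rw [← hS, ← relIndex_map_map_of_injective S _ M.subtype_injective, subgroupOf_map_subtype,
        inf_eq_left.2 hsub.le])
    intro x hx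
    obtain ⟨y, hy, hyx⟩ := h2 hx
    rwa [← Subtype.ext hyx]

/-- A nontrivial finite group has a largest prime divisor of its order. -/
theorem exists_largest_prime_dvd_card (G : Type*) [Group G] [Finite G] [Nontrivial G] :
    ∃ r : ℕ, r.Prime ∧ r ∣ Nat.card G ∧ ∀ s : ℕ, s.Prime → s ∣ Nat.card G → s ≤ r := by
  have hne : (Nat.card G).primeFactors.Nonempty :=
    Nat.nonempty_primeFactors.2 Finite.one_lt_card
  have hr := Finset.max'_mem _ hne
  refine ⟨_, Nat.prime_of_mem_primeFactors hr, Nat.dvd_of_mem_primeFactors hr, fun s hs hsd =>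
    Finset.le_max' _ _ (Nat.mem_primeFactors.2 ⟨hs, hsd, Nat.card_pos.ne'⟩)⟩

/-! ### Groups of the class whose normal subgroups of prime power order are `q`-groups. -/

namespace SmU

variable {G : Type u} [Group G] (hG : SmU G) {q : ℕ} [Fact q.Prime]
  (h : ∀ r : ℕ, r.Prime → r ≠ q → ∀ K : Subgroup G, K.Normal → IsPGroup r K → K = ⊥)
include hG h

/-- The Sylow subgroup for the largest prime divisor is normal and nontrivial, so that prime must be
`q`. -/
theorem sylow_normal_of_forall_normal (Q : Sylow q G) : (Q : Subgroup G).Normal := by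
  have := hG.finite
  rcases subsingleton_or_nontrivial G with hs | hs
  · rw [Subsingleton.elim (Q : Subgroup G) ⊥]
    infer_instance
  obtain ⟨r, hr, hrd, hle⟩ := exists_largest_prime_dvd_card G
  have := Fact.mk hr
  obtain rfl : r = q := by
    by_contra hrq
    exact (default : Sylow r G).ne_bot_of_dvd_card hrd
      (h r hr hrq _ (hG.largestSylowNormal r hr hle default) (default : Sylow r G).2)
  exact hG.largestSylowNormal r hr hle Q

/-- If a group in `smU` has no nontrivial normal `r`-subgroup for the primes `r ≠ q`, then its
Sylow `q`-subgroup contains its centraliser. -/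
theorem isPGroup_centralizer_sylow (Q : Sylow q G) :
    IsPGroup q (centralizer ((Q : Subgroup G) : Set G)) := by
  have := hG.finite
  have hQn := hG.sylow_normal_of_forall_normal h Q
  set C := centralizer ((Q : Subgroup G) : Set G)
  let S : Sylow q C := default
  -- As `Q` is normal, `S` lies in `Q` and is central in `C`, so Burnside's theorem yields a normal
  -- complement `L` to `S` in `C`.
  have hSC : normalizer ((S : Subgroup C) : Set C) ≤ centralizer ((S : Subgroup C) : Set C) := by
    intro x _
    rw [mem_centralizer_iff]
    intro y hy
    have hyQ : (y : G) ∈ Q := (S.2.map C.subtype).le_sylow_of_le_normalizer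
      (le_top.trans (normalizer_eq_top_iff.2 hQn).ge) (mem_map_of_mem _ hy)
    exact Subtype.ext (mem_centralizer_iff.1 x.2 _ hyQ)
  set L := (MonoidHom.transferSylow S hSC).ker with hL
  have hLi : L.index = Nat.card S :=
    (MonoidHom.ker_transferSylow_isComplement' S hSC).symm.index_eq_card
  obtain ⟨n, hn⟩ := IsPGroup.iff_card.1 S.2
  -- Otherwise the Sylow subgroup of `L` for its largest prime `r ≠ q` is normal, hence
  -- characteristic, in `C`, and so is a nontrivial normal `r`-subgroup of `G`.
  have hLb : L = ⊥ := by
    by_contra hLb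
    have := (nontrivial_iff_ne_bot L).2 hLb
    obtain ⟨r, hr, hrd, hle⟩ := exists_largest_prime_dvd_card L
    have := Fact.mk hr
    have hrq : r ≠ q := by
      rintro rfl
      exact MonoidHom.not_dvd_card_ker_transferSylow S hSC hrd
    let R : Sylow r C := default
    have hRL : (R : Subgroup C) ≤ L := by
      refine le_of_isPGroup_of_index R.2 ?_
      rw [hLi, hn]
      exact fun hd => hrq ((Nat.prime_dvd_prime_iff_eq hr Fact.out).1 (hr.dvd_of_dvd_pow hd))
    have hRn : (R : Subgroup C).Normal := R.normal_of_le_of_normal hRL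
      (((hG.subgroup C).subgroup L).largestSylowNormal r hr hle (R.subtype hRL))
    have := R.characteristic_of_normal hRn
    have hb := h r hr hrq ((R : Subgroup C).map C.subtype) inferInstance (R.2.map _)
    rw [map_eq_bot_iff_of_injective _ C.subtype_injective] at hb
    exact R.ne_bot_of_dvd_card (hrd.trans L.card_subgroup_dvd_card) hb
  rw [hLb, index_bot, hn] at hLi
  exact .of_card hLi

/-- If a group in `smU` has no nontrivial normal `r`-subgroup for the primes `r ≠ q`, then its
Sylow `p`-subgroups, for `p ≠ q`, are trivial or elementary abelian with `p ∣ q - 1`. -/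
theorem sylow_elementary {p : ℕ} [Fact p.Prime] (hpq : p ≠ q) (P : Sylow p G) :
    (P : Subgroup G) = ⊥ ∨ p ∣ q - 1 ∧ (∀ x ∈ (P : Subgroup G), x ^ p = 1) ∧
      (P : Subgroup G) ≤ centralizer ((P : Subgroup G) : Set G) := by
  have := hG.finite
  let Q : Sylow q G := default
  have hQn := hG.sylow_normal_of_forall_normal h Q
  have hC := hG.isPGroup_centralizer_sylow h Q
  -- Such an `F` centralises `Q`, and that centraliser is a `q`-group. It is applied to `P` itself
  -- if `p ∤ q - 1`, and otherwise to `p`-th powers and commutators, which lie in every subgroup of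
  -- index `p`.
  have key : ∀ F ≤ (P : Subgroup G), (p ∣ q - 1 → ∀ S ≤ (P : Subgroup G),
      S.relIndex P = p → F ≤ S) → F = ⊥ := fun F hF hFS => by
    have h1 := le_centralizer_of_submodularIn_sup hpq P.2 Q.2
      ((hG.submodularIn P).mono le_sup_left le_top) hF hFS
    have h2 := (IsPGroup.disjoint_of_ne p q hpq _ _ P.2 hC).eq_bot
    exact eq_bot_iff.2 ((le_inf hF h1).trans h2.le)
  by_cases hd : p ∣ q - 1
  swap
  · exact .inl (key P le_rfl fun hd' => absurd hd' hd)
  have hnormal : ∀ S : Subgroup G, S.relIndex P = p → (S.subgroupOf P).Normal := by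
    intro S hS
    refine normal_of_index_eq_minFac_card ?_
    change S.relIndex P = _
    obtain ⟨n, hn⟩ := IsPGroup.iff_card.1 P.2
    have hn0 : n ≠ 0 := by
      rintro rfl
      rw [pow_zero] at hn
      have h1 := relIndex_dvd_card S (P : Subgroup G)
      rw [hS, hn, Nat.dvd_one] at h1
      exact (Fact.out : p.Prime).one_lt.ne' h1
    rw [hS, hn, Nat.Prime.pow_minFac Fact.out hn0]
  have key' : ∀ w ∈ (P : Subgroup G), (∀ S : Subgroup G, S.relIndex P = p → w ∈ S) → w = 1 :=
    fun w hw hS => zpowers_eq_bot.1 (key _ (zpowers_le.2 hw) fun _ S _ h => zpowers_le.2 (hS S h))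
  refine .inr ⟨hd, fun x hx => key' _ (pow_mem hx p) fun S hS => ?_, fun x hx => ?_⟩
  · have := hnormal S hS
    have h1 := pow_index_mem (S.subgroupOf P) ⟨x, hx⟩
    rw [show (S.subgroupOf P).index = p from hS] at h1
    exact h1
  · rw [mem_centralizer_iff]
    intro y hy
    rw [← inv_mul_eq_one]
    refine key' _ (mul_mem (inv_mem (mul_mem hy hx)) (mul_mem hx hy)) fun S hS => ?_
    have := hnormal S hS
    have hcyc : IsCyclic ((P : Subgroup G) ⧸ S.subgroupOf P) :=
      isCyclic_of_prime_card (p := p) (by rw [← index_eq_card]; exact hS)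
    have := hcyc.isMulCommutative.is_comm.comm (QuotientGroup.mk (⟨y, hy⟩ : (P : Subgroup G)))
      (QuotientGroup.mk (⟨x, hx⟩ : (P : Subgroup G)) : (P : Subgroup G) ⧸ S.subgroupOf P)
    rw [← QuotientGroup.mk_mul, ← QuotientGroup.mk_mul, QuotientGroup.eq] at this
    exact this

end SmU

/-! ### Saturation: quotients by normal subgroups inside the Frattini subgroup. -/

theorem Subgroup.eq_top_of_sup_le_frattini {G : Type*} [Group G] [Finite G] {H N : Subgroup G}
    (hN : N ≤ frattini G) (h : H ⊔ N = ⊤) : H = ⊤ :=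
  frattini_nongenerating (top_le_iff.1 (h.ge.trans (sup_le_sup_left hN H)))

/-- Modulo a normal subgroup contained in the Frattini subgroup, no new nontrivial normal
`r`-subgroups arise. -/
theorem eq_bot_of_normal_quotient_of_le_frattini {G : Type*} [Group G] [Finite G]
    {E : Subgroup G} [E.Normal] (hE : E ≤ frattini G) {r : ℕ} [Fact r.Prime]
    (h : ∀ K : Subgroup G, K.Normal → IsPGroup r K → K = ⊥) {K : Subgroup (G ⧸ E)} [K.Normal]
    (hK : IsPGroup r K) : K = ⊥ := by
  have hsurj := QuotientGroup.mk'_surjective E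
  set T := K.comap (QuotientGroup.mk' E) with hT
  let R₀ : Sylow r T := default
  set R := (R₀ : Subgroup T).map T.subtype with hR
  -- The index of `R E` in `T` divides both a power of `r` and a number prime to `r`.
  have hTle : T ≤ R ⊔ E := by
    rw [← relIndex_eq_one]
    have h1 : (R ⊔ E).relIndex T ∣ (R₀ : Subgroup T).index := by
      refine (relIndex_dvd_of_le_left T (le_sup_left : R ≤ R ⊔ E)).trans ?_
      rw [relIndex, subgroupOf, hR, comap_map_eq_self_of_injective T.subtype_injective]
    have h2 : (R ⊔ E).relIndex T ∣ Nat.card K := by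
      refine (relIndex_dvd_of_le_left T (le_sup_right : E ≤ R ⊔ E)).trans ?_
      have := relIndex_ker T (QuotientGroup.mk' E)
      rw [QuotientGroup.ker_mk', hT, map_comap_eq_self_of_surjective hsurj] at this
      rw [hT, this]
    obtain ⟨n, hn⟩ := IsPGroup.iff_card.1 hK
    rw [hn] at h2
    obtain ⟨m, -, hm⟩ := (Nat.dvd_prime_pow Fact.out).1 h2
    rcases m.eq_zero_or_pos with rfl | hm0
    · rw [hm, pow_zero]
    · exact absurd ((dvd_pow_self r hm0.ne').trans (hm ▸ h1)) R₀.not_dvd_index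
  -- By the Frattini argument `G = N(R) T = N(R) E`, and `E` consists of nongenerators, so `R` is
  -- normal in `G`.
  have hN : normalizer (R : Set G) ⊔ T = ⊤ := R₀.normalizer_sup_eq_top
  have hRn : R.Normal := by
    refine normalizer_eq_top_iff.1 (eq_top_of_sup_le_frattini hE (top_le_iff.1 (hN.ge.trans ?_)))
    exact sup_le le_sup_left (hTle.trans (sup_le_sup_right le_normalizer E))
  have hRb := h R hRn (R₀.2.map _)
  rw [hRb, bot_sup_eq] at hTle
  rw [eq_bot_iff, ← comap_le_comap_of_surjective hsurj, MonoidHom.comap_bot,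
    QuotientGroup.ker_mk']
  exact hTle

theorem submodularIn_sup_of_elementary {G : Type*} [Group G] [Finite G] {p q : ℕ}
    [Fact p.Prime] [Fact q.Prime] {P N : Subgroup G} [N.Normal] (hPp : ∀ x ∈ P, x ^ p = 1)
    (hPc : P ≤ centralizer (P : Set G)) (hNq : ∀ x ∈ N, x ^ q = 1)
    (hNc : N ≤ centralizer (N : Set G)) (hd : p ∣ q - 1) : P.SubmodularIn (P ⊔ N) := by
  rw [← submodularIn_iff_subgroupOf le_sup_left]
  exact submodularIn_of_elementary (N := N.subgroupOf (P ⊔ N))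
    (fun x hx => Subtype.ext (hPp x hx))
    (fun x hx => mem_centralizer_iff.2 fun y hy =>
      Subtype.ext (mem_centralizer_iff.1 (hPc hx) y hy))
    (fun x hx => Subtype.ext (hNq x hx))
    (fun x hx => mem_centralizer_iff.2 fun y hy =>
      Subtype.ext (mem_centralizer_iff.1 (hNc hx) y hy))
    hd (by rw [← subgroupOf_sup le_sup_left le_sup_right, subgroupOf_self])

namespace SmU

variable {G : Type u} [Group G]

theorem quotient_map_mk' {N : Subgroup G} [N.Normal] (h : SmU (G ⧸ N)) (E : Subgroup G) [E.Normal]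
    [(N.map (QuotientGroup.mk' E)).Normal] :
    SmU ((G ⧸ E) ⧸ N.map (QuotientGroup.mk' E)) := by
  refine h.of_surjective (QuotientGroup.map N _ (QuotientGroup.mk' E) (le_comap_map _ _))
    fun x => ?_
  obtain ⟨y, rfl⟩ := QuotientGroup.mk'_surjective _ x
  obtain ⟨g, rfl⟩ := QuotientGroup.mk'_surjective _ y
  exact ⟨QuotientGroup.mk' N g, rfl⟩

/-- A group without nontrivial normal `r`-subgroups, for the primes `r ≠ q`, belongs to `smU` as
soon as its quotient by an elementary abelian normal `q`-subgroup inside the Frattini subgroup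
does. -/
theorem of_quotient_elementary [Finite G] {q : ℕ} [Fact q.Prime] {E : Subgroup G} [E.Normal]
    (hE : E ≤ frattini G) (hEq : ∀ x ∈ E, x ^ q = 1) (hEc : E ≤ centralizer (E : Set G))
    (h : ∀ r : ℕ, r.Prime → r ≠ q → ∀ K : Subgroup G, K.Normal → IsPGroup r K → K = ⊥)
    (hG : SmU (G ⧸ E)) : SmU G := by
  have hsurj := QuotientGroup.mk'_surjective E
  have hEp : IsPGroup q E := fun x => ⟨1, by rw [pow_one]; exact Subtype.ext (hEq x x.2)⟩
  refine ⟨inferInstance, fun p hp P => submodularIn_top_iff.1 ?_⟩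
  have := Fact.mk hp
  have h1 : ((P : Subgroup G) ⊔ E).SubmodularIn ⊤ := by
    have := (hG.submodularIn (P.mapSurjective hsurj)).comap (QuotientGroup.mk' E)
    rwa [Sylow.coe_mapSurjective, comap_map_eq, QuotientGroup.ker_mk', comap_top] at this
  rcases eq_or_ne p q with rfl | hpq
  · rwa [sup_of_le_left] at h1
    rw [← sup_eq_left]
    exact P.3 (P.2.to_sup_of_normal_right hEp) le_sup_left
  have hPE : (P : Subgroup G) ⊓ E = ⊥ := (IsPGroup.disjoint_of_ne p q hpq _ _ P.2 hEp).eq_bot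
  have hone : ∀ x ∈ (P : Subgroup G), QuotientGroup.mk' E x = 1 → x = 1 := fun x hx hx1 => by
    rw [← mem_bot, ← hPE]
    exact ⟨hx, (QuotientGroup.eq_one_iff x).1 hx1⟩
  -- `G ⧸ E` inherits the absence of normal `r`-subgroups. Since `P ⊓ E = 1`, the structure of the
  -- Sylow subgroup of `G ⧸ E` carries over to `P`.
  have hbar := hG.sylow_elementary (fun r hr hrq K hKn hK => by
    have := Fact.mk hr
    exact eq_bot_of_normal_quotient_of_le_frattini hE (h r hr hrq) hK) hpq (P.mapSurjective hsurj)
  rw [Sylow.coe_mapSurjective] at hbar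
  rcases hbar with hb | ⟨hd, hpow, hcomm⟩
  · have : (P : Subgroup G) = ⊥ := eq_bot_iff.2 fun x hx => hone x hx <| by
      rw [← mem_bot, ← hb]
      exact mem_map_of_mem _ hx
    rw [this]
    exact .single (.bot ⊤)
  refine Relation.ReflTransGen.trans (submodularIn_sup_of_elementary (p := p) (q := q)
    (fun x hx => ?_) (fun x hx => mem_centralizer_iff.2 fun y hy => ?_) hEq hEc hd) h1
  · exact hone _ (pow_mem hx p) (by rw [map_pow, hpow _ (mem_map_of_mem _ hx)])
  · rw [← inv_mul_eq_one]
    refine hone _ (mul_mem (inv_mem (mul_mem hy hx)) (mul_mem hx hy)) ?_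
    rw [map_mul, map_inv, map_mul, map_mul, inv_mul_eq_one]
    exact mem_centralizer_iff.1 (hcomm (mem_map_of_mem _ hx)) _ (mem_map_of_mem _ hy)

/-- A finite group belongs to `smU` if its quotient by a normal subgroup contained in the Frattini
subgroup does. -/
theorem of_quotient_le_frattini [Finite G] {N : Subgroup G} [hNn : N.Normal]
    (hN : N ≤ frattini G) (h : SmU (G ⧸ N)) : SmU G := by
  induction hc : Nat.card G using Nat.strong_induction_on generalizing G with
  | _ n ih =>
  subst hc
  have hquot : ∀ (E : Subgroup G) [E.Normal], E ≠ ⊥ → SmU (G ⧸ E) := by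
    intro E _ hEb
    have hsurj := QuotientGroup.mk'_surjective E
    have hn : (N.map (QuotientGroup.mk' E)).Normal := hNn.map _ hsurj
    refine ih (Nat.card (G ⧸ E)) ?_ (N := N.map (QuotientGroup.mk' E)) ?_
      (h.quotient_map_mk' E) rfl
    · have h1 := E.card_mul_index
      have h2 : 1 < Nat.card E := (one_lt_card_iff_ne_bot E).2 hEb
      have h3 : 0 < E.index := Nat.pos_of_ne_zero index_ne_zero_of_finite
      rw [← index_eq_card]
      nlinarith
    · exact map_le_iff_le_comap.2 (hN.trans (frattini_le_comap_frattini_of_surjective hsurj))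
  by_cases hNb : N = ⊥
  · refine h.of_injective (QuotientGroup.mk' N) ((MonoidHom.ker_eq_bot_iff _).1 ?_)
    rw [QuotientGroup.ker_mk', hNb]
  have := (nontrivial_iff_ne_bot N).2 hNb
  obtain ⟨q, hq, hqd, -⟩ := exists_largest_prime_dvd_card N
  have := Fact.mk hq
  let S : Sylow q N := default
  -- The Frattini argument gives `G = N(S) N`, and `N` consists of nongenerators.
  have hSn : ((S : Subgroup N).map N.subtype).Normal :=
    normalizer_eq_top_iff.1 (eq_top_of_sup_le_frattini hN S.normalizer_sup_eq_top)
  obtain ⟨E, hEn, hES, hEb, hEq, hEc⟩ := (S.2.map N.subtype).exists_normal_elementary fun hb => by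
    have hb' := (map_eq_bot_iff_of_injective (S : Subgroup N) N.subtype_injective).1 hb
    exact S.ne_bot_of_dvd_card hqd hb'
  have hEN : E ≤ N := hES.trans (map_subtype_le _)
  by_cases hK : ∀ r : ℕ, r.Prime → r ≠ q → ∀ K : Subgroup G, K.Normal → IsPGroup r K → K = ⊥
  · exact of_quotient_elementary (hEN.trans hN) hEq hEc hK (hquot E hEb)
  push Not at hK
  obtain ⟨r, hr, hrq, K, hKn, hKr, hKb⟩ := hK
  have := Fact.mk hr
  -- An `r`-group and a `q`-group meet trivially, so `G` embeds in `G/K × G/E`.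
  refine (hquot K hKb).of_ker_inf_ker (hquot E hEb) (QuotientGroup.mk' K)
    (QuotientGroup.mk' E) ?_
  rw [QuotientGroup.ker_mk', QuotientGroup.ker_mk']
  exact (IsPGroup.disjoint_of_ne r q hrq _ _ hKr ((S.2.map _).to_le hES)).eq_bot

theorem isFormation : IsFormation (fun (K : Type u) [Group K] => SmU K) where
  finite _ _ h := h.finite
  iso _ _ _ _ h e := let ⟨e⟩ := e; h.of_surjective e.toMonoidHom e.surjective
  quotient _ _ h N _ := h.quotient N
  subdirect _ _ _ A B _ _ := quotient_inf A B

theorem isHereditary : IsHereditary (fun (K : Type u) [Group K] => SmU K) :=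
  fun _ _ h H => h.subgroup H

theorem isSaturated : IsSaturated (fun (K : Type u) [Group K] => SmU K) :=
  fun _ _ _ h => of_quotient_le_frattini le_rfl h

end SmU

end

theorem theorem3p1 {G : Type u} [Group G] [Finite G] :
    (SmU G → ∀ H : Subgroup G, SmU H) ∧
    (SmU G → ∀ (N : Subgroup G) [N.Normal], SmU (G ⧸ N)) ∧
    (∀ (N₁ N₂ : Subgroup G) [N₁.Normal] [N₂.Normal],
      SmU (G ⧸ N₁) → SmU (G ⧸ N₂) → SmU (G ⧸ (N₁ ⊓ N₂))) ∧
    (∀ (H₁ H₂ : Subgroup G) [H₁.Normal] [H₂.Normal],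
      SmU H₁ → SmU H₂ → H₁ ⊓ H₂ = ⊥ →
        SmU (H₁ ⊔ H₂ : Subgroup G) ∧ SmU (H₁ × H₂)) ∧
    (SmU (G ⧸ frattini G) → SmU G) ∧
    (IsFormation (fun (K : Type u) [Group K] => SmU K) ∧
      IsHereditary (fun (K : Type u) [Group K] => SmU K) ∧
      IsSaturated (fun (K : Type u) [Group K] => SmU K)) :=
  ⟨SmU.subgroup, fun h N _ => h.quotient N, fun N₁ N₂ _ _ => SmU.quotient_inf N₁ N₂,
    fun H₁ H₂ _ _ h₁ h₂ h => ⟨SmU.sup_of_disjoint H₁ H₂ h₁ h₂ h, h₁.prod h₂⟩,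
    SmU.of_quotient_le_frattini le_rfl, SmU.isFormation, SmU.isHereditary, SmU.isSaturated⟩
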